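/- **Setting.** Let $\mathfrak g_2=\mathfrak{sl}(3,\mathbb R)\oplus\mathbb R^3\oplus(\mathbb R^3)^*$ be the split real Lie algebra of type $G_2$, with bracket $[X,Y]=XY-YX$, $[X,v]=Xv$, $[X,\alpha]=-\alpha\circ X$, $[u,v]=-\frac43T(u\wedge v)$, $[\alpha,\beta]=\frac43S(\alpha\wedge\beta)$, $[v,\alpha]=\frac43\big((v^i\alpha^j)_{ij}-\frac13\alpha(v)I_3\big)$ for $X,Y\in\mathfrak{sl}(3,\mathbb R)$, $u,v\in\mathbb R^3$, $\alpha,\beta\in(\mathbb R^3)^*$, where $T:\bigwedge^2\mathbb R^3\to(\mathbb R^3)^*$ and $S:\bigwedge^2(\mathbb R^3)^*\to\mathbb R^3$ are the isomorphisms given by the standard volume forms (in coordinates, cross products). Let $\mathfrak h$ be the Cartan subalgebra of diagonal traceless matrices, $\lambda_i(\mathrm{diag}(a_1,a_2,a_3))=a_i$, with positive roots $\lambda_i-\lambda_j$ $(i<j)$, $\lambda_1,\lambda_2,-\lambda_3$ and simple roots $\alpha_1=\lambda_1-\lambda_2$, $\alpha_2=\lambda_2$. Let $G_2=\mathrm{Aut}(\mathfrak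 g_2)$, let $K\cong SO(4)$ be its maximal compact subgroup of automorphisms commuting with the Cartan involution $\theta(X+v+\alpha)=-X^T-\alpha^*-v^*$, and let $\mathfrak k$ be its Lie algebra, with basis $X_1=E_{21}-E_{12}$, $X_2=E_{31}-E_{13}$, $X_3=E_{32}-E_{23}$, $Y_i=e_i-\epsilon_i$. Let $\mathfrak p$ be the sum of $\mathfrak h$, all positive root spaces and the root space of $-\alpha_2$, let $P$ be the stabilizer of $\mathfrak p$ in $G_2$, $H=K\cap P$, and let $\mathbb F_{\{\alpha_2\}}=G_2/P=K/H$. With $B$ the Killing form of $\mathfrak k$ and $(\cdot,\cdot)=-B$, let $\mathfrak m$ be the orthogonal complement of $\mathfrak k\cap\mathfrak p=\mathrm{span}\{Y_2\}$ in $\mathfrak k$; let $[X,Y]_{\mathfrak m}$ be the $\mathfrak m$-component of $[X,Y]$, and put $$\mathfrak m_1=\mathrm{span}\{10X_2+3Y_2\},\quad \mathfrak m_2=\mathrm{span}\{2X_1+3Y_3,\,2X_3+3Y_1\},\quad \mathfrak m_3=\mathrm{span}\{2X_1-Y_3,\,2X_3-Y_1\},$$ the pairwise inequivalent irreducible summands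 of the isotropy representation on $\mathfrak m$. The $K$-invariant Riemannian metrics on $\mathbb F_{\{\alpha_2\}}$ are identified with the $\mathrm{Ad}(H)$-invariant inner products $\langle\cdot,\cdot\rangle$ on $\mathfrak m$, and the Ricci tensor of such a metric is $$\mathrm{Ric}(X,Y)=-\tfrac12\sum_i\langle[X,v_i]_{\mathfrak m},[Y,v_i]_{\mathfrak m}\rangle-\tfrac12B(X,Y)+\tfrac14\sum_{i,j}\langle[v_i,v_j]_{\mathfrak m},X\rangle\langle[v_i,v_j]_{\mathfrak m},Y\rangle-\Big\langle U(X,Y),\sum_iU(v_i,v_i)\Big\rangle$$ for any $\langle\cdot,\cdot\rangle$-orthonormal basis $(v_i)$ of $\mathfrak m$, where $2\langle U(u,v),w\rangle=\langle[w,u]_{\mathfrak m},v\rangle+\langle[w,v]_{\mathfrak m},u\rangle$. **Proposition (collapse of the homogeneous Ricci flow on $\mathbb F_{\{\alpha_2\}}$).** Let $0<T\le\infty$ and let $t\mapsto\langle\cdot,\cdot\rangle_t$, $t\in[0,T)$, be a solution of the homogeneous Ricci flow $\frac{d}{dt}\langle\cdot,\cdot\rangle_t=-2\,\mathrm{Ric}(\langle\cdot,\cdot\rangle_t)$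 through $K$-invariant metrics on $\mathbb F_{\{\alpha_2\}}$, maximal in the sense that it does not extend to a solution on a longer interval $[0,T')$. Let $A_t$ be its metric operator, $\langle X,Y\rangle_t=(A_tX,Y)$. Then the metric collapses at the end of the flow: $T<\infty$, there are positive functions $\mu_1,\mu_2,\mu_3$ on $[0,T)$ with $A_t|_{\mathfrak m_i}=\mu_i(t)\,\mathrm{Id}$ for all $t\in[0,T)$ and $i=1,2,3$, and, as $t\to T^-$, $\mu_1(t)\to0$ and moreover $\mu_2(t)\to0$ or $\mu_3(t)\to0$. -/

import Mathlib

namespace G2Flag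

open scoped Matrix

noncomputable section

/-! ### The split real form of the Lie algebra of type G₂ -/

/-- The space `sl(3)` of real traceless `3 × 3` matrices. -/
abbrev Sl3 : Submodule ℝ (Matrix (Fin 3) (Fin 3) ℝ) :=
  LinearMap.ker (Matrix.traceLinearMap (Fin 3) ℝ ℝ)

/-- The space `sl(3) ⊕ ℝ³ ⊕ (ℝ³)*`; a covector is given by its coordinates in the dual basis. -/
def SplitG2 : Type := Sl3 × (Fin 3 → ℝ) × (Fin 3 → ℝ)

namespace SplitG2

instance : AddCommGroup SplitG2 := inferInstanceAs (AddCommGroup (Sl3 × (Fin 3 → ℝ) × (Fin 3 → ℝ)))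
instance : Module ℝ SplitG2 := inferInstanceAs (Module ℝ (Sl3 × (Fin 3 → ℝ) × (Fin 3 → ℝ)))

/-- The `sl(3)`-component. -/
def mat : SplitG2 →ₗ[ℝ] Matrix (Fin 3) (Fin 3) ℝ :=
  Sl3.subtype ∘ₗ LinearMap.fst ℝ Sl3 ((Fin 3 → ℝ) × (Fin 3 → ℝ))

/-- The `ℝ³`-component. -/
def vec : SplitG2 →ₗ[ℝ] (Fin 3 → ℝ) :=
  LinearMap.fst ℝ (Fin 3 → ℝ) (Fin 3 → ℝ) ∘ₗ LinearMap.snd ℝ Sl3 ((Fin 3 → ℝ) × (Fin 3 → ℝ))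

/-- The `(ℝ³)*`-component. -/
def cov : SplitG2 →ₗ[ℝ] (Fin 3 → ℝ) :=
  LinearMap.snd ℝ (Fin 3 → ℝ) (Fin 3 → ℝ) ∘ₗ LinearMap.snd ℝ Sl3 ((Fin 3 → ℝ) × (Fin 3 → ℝ))

/-- The element `M + v + α` of `sl(3) ⊕ ℝ³ ⊕ (ℝ³)*`. -/
def mk (M : Matrix (Fin 3) (Fin 3) ℝ) (hM : M.trace = 0) (v α : Fin 3 → ℝ) : SplitG2 :=
  (⟨M, hM⟩, v, α)

@[simp] theorem mat_mk (M : Matrix (Fin 3) (Fin 3) ℝ) (hM : M.trace = 0) (v α : Fin 3 → ℝ) :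
    mat (mk M hM v α) = M := rfl
@[simp] theorem vec_mk (M : Matrix (Fin 3) (Fin 3) ℝ) (hM : M.trace = 0) (v α : Fin 3 → ℝ) :
    vec (mk M hM v α) = v := rfl
@[simp] theorem cov_mk (M : Matrix (Fin 3) (Fin 3) ℝ) (hM : M.trace = 0) (v α : Fin 3 → ℝ) :
    cov (mk M hM v α) = α := rfl

theorem trace_mat (x : SplitG2) : (mat x).trace = 0 := x.1.2

theorem mat_two_two (x : SplitG2) : mat x 2 2 = -mat x 0 0 - mat x 1 1 := by
  have h := trace_mat x
  rw [Matrix.trace_fin_three] at h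
  linarith

theorem ext' {x y : SplitG2} (h₁ : mat x = mat y) (h₂ : vec x = vec y) (h₃ : cov x = cov y) :
    x = y :=
  Prod.ext (Subtype.ext h₁) (Prod.ext h₂ h₃)

/-- The traceless matrix `[v, α] = (4/3) (vⁱαʲ - (1/3) α(v) I)` for `v ∈ ℝ³`, `α ∈ (ℝ³)*`. -/
def tensor (v α : Fin 3 → ℝ) : Matrix (Fin 3) (Fin 3) ℝ :=
  (4 / 3 : ℝ) • (Matrix.vecMulVec v α - ((1 / 3 : ℝ) * (α ⬝ᵥ v)) • (1 : Matrix (Fin 3) (Fin 3) ℝ))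

theorem trace_tensor (v α : Fin 3 → ℝ) : (tensor v α).trace = 0 := by
  simp [tensor, dotProduct, Fin.sum_univ_three]
  ring

/-- The bracket of `sl(3) ⊕ ℝ³ ⊕ (ℝ³)*`: `[X, Y] = XY - YX`, `[X, v] = Xv`, `[X, α] = -α ∘ X`,
`[u, v] = -(4/3) T(u ∧ v)`, `[α, β] = (4/3) S(α ∧ β)`, `[v, α] = (4/3)(vⁱαʲ - (1/3) α(v) I)`, where
`T : Λ²ℝ³ → (ℝ³)*` and `S : Λ²(ℝ³)* → ℝ³` are the isomorphisms given by the standard volume forms,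
in coordinates the cross product. -/
instance : Bracket SplitG2 SplitG2 where
  bracket x y :=
    mk (mat x * mat y - mat y * mat x + tensor (vec x) (cov y) - tensor (vec y) (cov x))
      (by
        rw [Matrix.trace_sub, Matrix.trace_add, Matrix.trace_sub, Matrix.trace_mul_comm,
          trace_tensor, trace_tensor]
        simp)
      (mat x *ᵥ vec y - mat y *ᵥ vec x + (4 / 3 : ℝ) • (cov x ⨯₃ cov y))
      (-(cov y ᵥ* mat x) + cov x ᵥ* mat y - (4 / 3 : ℝ) • (vec x ⨯₃ vec y))

theorem mat_lie (x y : SplitG2) : mat ⁅x, y⁆ =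
    mat x * mat y - mat y * mat x + tensor (vec x) (cov y) - tensor (vec y) (cov x) := rfl
theorem vec_lie (x y : SplitG2) : vec ⁅x, y⁆ =
    mat x *ᵥ vec y - mat y *ᵥ vec x + (4 / 3 : ℝ) • (cov x ⨯₃ cov y) := rfl
theorem cov_lie (x y : SplitG2) : cov ⁅x, y⁆ =
    -(cov y ᵥ* mat x) + cov x ᵥ* mat y - (4 / 3 : ℝ) • (vec x ⨯₃ vec y) := rfl

theorem tensor_apply (v α : Fin 3 → ℝ) (i j : Fin 3) : tensor v α i j =
    4 / 3 * (v i * α j - if i = j then (1 / 3) * (α 0 * v 0 + α 1 * v 1 + α 2 * v 2) else 0) := by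
  simp [tensor, Matrix.vecMulVec_apply, dotProduct, Fin.sum_univ_three, Matrix.one_apply]

theorem mat_lie_apply (x y : SplitG2) (i j : Fin 3) : mat ⁅x, y⁆ i j =
    (mat x i 0 * mat y 0 j + mat x i 1 * mat y 1 j + mat x i 2 * mat y 2 j)
    - (mat y i 0 * mat x 0 j + mat y i 1 * mat x 1 j + mat y i 2 * mat x 2 j)
    + tensor (vec x) (cov y) i j - tensor (vec y) (cov x) i j := by
  simp [mat_lie, Matrix.mul_apply, Fin.sum_univ_three]

theorem vec_lie_apply (x y : SplitG2) (i : Fin 3) : vec ⁅x, y⁆ i =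
    (mat x i 0 * vec y 0 + mat x i 1 * vec y 1 + mat x i 2 * vec y 2)
    - (mat y i 0 * vec x 0 + mat y i 1 * vec x 1 + mat y i 2 * vec x 2)
    + 4 / 3 * ![cov x 1 * cov y 2 - cov x 2 * cov y 1, cov x 2 * cov y 0 - cov x 0 * cov y 2,
        cov x 0 * cov y 1 - cov x 1 * cov y 0] i := by
  fin_cases i <;> simp [vec_lie, Matrix.mulVec, dotProduct, Fin.sum_univ_three, cross_apply]

theorem cov_lie_apply (x y : SplitG2) (i : Fin 3) : cov ⁅x, y⁆ i =
    -(cov y 0 * mat x 0 i + cov y 1 * mat x 1 i + cov y 2 * mat x 2 i)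
    + (cov x 0 * mat y 0 i + cov x 1 * mat y 1 i + cov x 2 * mat y 2 i)
    - 4 / 3 * ![vec x 1 * vec y 2 - vec x 2 * vec y 1, vec x 2 * vec y 0 - vec x 0 * vec y 2,
        vec x 0 * vec y 1 - vec x 1 * vec y 0] i := by
  fin_cases i <;> simp [cov_lie, Matrix.vecMul, dotProduct, Fin.sum_univ_three, cross_apply]

set_option maxHeartbeats 4000000 in
theorem leibniz (x y z : SplitG2) : ⁅x, ⁅y, z⁆⁆ = ⁅⁅x, y⁆, z⁆ + ⁅y, ⁅x, z⁆⁆ := by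
  refine ext' ?_ ?_ ?_
  · ext i j
    fin_cases i <;> fin_cases j <;>
    · simp [map_add, mat_lie_apply, vec_lie_apply, cov_lie_apply, tensor_apply, mat_two_two]
      ring
  · ext i
    fin_cases i <;>
    · simp [map_add, mat_lie_apply, vec_lie_apply, cov_lie_apply, tensor_apply, mat_two_two]
      ring
  · ext i
    fin_cases i <;>
    · simp [map_add, mat_lie_apply, vec_lie_apply, cov_lie_apply, tensor_apply, mat_two_two]
      ring

instance : LieRing SplitG2 where
  add_lie x y z := by
    refine ext' ?_ ?_ ?_ <;> ext i
    · rename_i j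
      simp [mat_lie_apply, tensor_apply]; split_ifs <;> ring
    · simp [vec_lie_apply]; fin_cases i <;> simp <;> ring
    · simp [cov_lie_apply]; fin_cases i <;> simp <;> ring
  lie_add x y z := by
    refine ext' ?_ ?_ ?_ <;> ext i
    · rename_i j
      simp [mat_lie_apply, tensor_apply]; split_ifs <;> ring
    · simp [vec_lie_apply]; fin_cases i <;> simp <;> ring
    · simp [cov_lie_apply]; fin_cases i <;> simp <;> ring
  lie_self x := by
    refine ext' ?_ ?_ ?_ <;> ext i
    · simp [mat_lie_apply]
    · simp [vec_lie_apply]; fin_cases i <;> simp <;> ring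
    · simp [cov_lie_apply]; fin_cases i <;> simp <;> ring
  leibniz_lie := leibniz

instance : LieAlgebra ℝ SplitG2 where
  lie_smul c x y := by
    refine ext' ?_ ?_ ?_ <;> ext i
    · rename_i j
      simp [mat_lie_apply, tensor_apply]; split_ifs <;> ring
    · simp [vec_lie_apply]; fin_cases i <;> simp <;> ring
    · simp [cov_lie_apply]; fin_cases i <;> simp <;> ring

/-! ### The Cartan involution, the maximal compact subalgebra and the flag -/

/-- The linear map underlying the Cartan involution `X + v + α ↦ -Xᵀ - α* - v*`. -/
def thetaLin : SplitG2 →ₗ[ℝ] SplitG2 where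
  toFun x := mk (-(mat x)ᵀ) (by rw [Matrix.trace_neg, Matrix.trace_transpose, trace_mat, neg_zero])
    (-cov x) (-vec x)
  map_add' x y := by
    refine ext' ?_ ?_ ?_
    · simp only [mat_mk, map_add, Matrix.transpose_add, neg_add]
    · simp only [vec_mk, map_add, neg_add]
    · simp only [cov_mk, map_add, neg_add]
  map_smul' c x := by
    refine ext' ?_ ?_ ?_
    · simp only [mat_mk, map_smul, Matrix.transpose_smul, smul_neg, RingHom.id_apply]
    · simp only [vec_mk, map_smul, smul_neg, RingHom.id_apply]
    · simp only [cov_mk, map_smul, smul_neg, RingHom.id_apply]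

theorem mat_thetaLin (x : SplitG2) (i j : Fin 3) : mat (thetaLin x) i j = -mat x j i := rfl
theorem vec_thetaLin (x : SplitG2) (i : Fin 3) : vec (thetaLin x) i = -cov x i := rfl
theorem cov_thetaLin (x : SplitG2) (i : Fin 3) : cov (thetaLin x) i = -vec x i := rfl

set_option maxHeartbeats 1000000 in
theorem thetaLin_lie (x y : SplitG2) : thetaLin ⁅x, y⁆ = ⁅thetaLin x, thetaLin y⁆ := by
  refine ext' ?_ ?_ ?_
  · ext i j
    simp only [mat_thetaLin, vec_thetaLin, cov_thetaLin, mat_lie_apply, tensor_apply,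
      eq_comm (a := j)]
    split_ifs <;> ring
  · ext i
    simp only [mat_thetaLin, vec_thetaLin, cov_thetaLin, vec_lie_apply, cov_lie_apply]
    fin_cases i <;>
    · simp
      ring
  · ext i
    simp only [mat_thetaLin, vec_thetaLin, cov_thetaLin, vec_lie_apply, cov_lie_apply]
    fin_cases i <;>
    · simp
      ring

/-- The Cartan involution `X + v + α ↦ -Xᵀ - α* - v*`. -/
def theta : SplitG2 →ₗ⁅ℝ⁆ SplitG2 :=
  { thetaLin with map_lie' := fun {x y} => thetaLin_lie x y }

@[simp] theorem mat_theta (x : SplitG2) : mat (theta x) = -(mat x)ᵀ := rfl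
@[simp] theorem vec_theta (x : SplitG2) : vec (theta x) = -cov x := rfl
@[simp] theorem cov_theta (x : SplitG2) : cov (theta x) = -vec x := rfl

/-- The Cartan subalgebra `h` of diagonal traceless matrices. -/
def cartan : Submodule ℝ SplitG2 where
  carrier := {x | (∀ i j, i ≠ j → mat x i j = 0) ∧ vec x = 0 ∧ cov x = 0}
  zero_mem' := by simp
  add_mem' := by
    rintro x y ⟨h₁, h₂, h₃⟩ ⟨h₁', h₂', h₃'⟩
    refine ⟨fun i j hij => ?_, ?_, ?_⟩
    · simp [h₁ i j hij, h₁' i j hij]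
    · simp [h₂, h₂']
    · simp [h₃, h₃']
  smul_mem' := by
    rintro c x ⟨h₁, h₂, h₃⟩
    refine ⟨fun i j hij => ?_, ?_, ?_⟩
    · simp [h₁ i j hij]
    · simp [h₂]
    · simp [h₃]

/-- The root space of the functional `c₀ λ₁ + c₁ λ₂ + c₂ λ₃` on the Cartan subalgebra, where
`λᵢ (diag (a₁, a₂, a₃)) = aᵢ`. -/
def rootSpace (c : Fin 3 → ℝ) : Submodule ℝ SplitG2 where
  carrier := {x | ∀ h ∈ cartan, ⁅h, x⁆ = (∑ i, c i * mat h i i) • x}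
  zero_mem' := by simp
  add_mem' := by
    intro x y hx hy h hh
    rw [lie_add, hx h hh, hy h hh, smul_add]
  smul_mem' := by
    intro r x hx h hh
    rw [lie_smul, hx h hh, smul_comm]

/-- The parabolic subalgebra `p_Θ` for `Θ = {α₂}`, with the simple roots `α₁ = λ₁ - λ₂`,
`α₂ = λ₂`: the sum of the Cartan subalgebra, of the root spaces of the positive roots
`λ₁ - λ₂, λ₁ - λ₃, λ₂ - λ₃, λ₁, λ₂, -λ₃`, and of the root space of `-α₂`. -/
def parabolic : Submodule ℝ SplitG2 :=
  cartan ⊔ rootSpace ![1, -1, 0] ⊔ rootSpace ![1, 0, -1] ⊔ rootSpace ![0, 1, -1] ⊔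
    rootSpace ![1, 0, 0] ⊔ rootSpace ![0, 1, 0] ⊔ rootSpace ![0, 0, -1] ⊔ rootSpace ![0, -1, 0]

/-- The group `G₂ = Aut(g₂)`, the connected adjoint group with Lie algebra `g₂`; the adjoint
representation of an automorphism is the automorphism itself. -/
abbrev AutG2 := SplitG2 ≃ₗ⁅ℝ⁆ SplitG2

/-- The maximal compact subgroup `K ≅ SO(4)` of `G₂`: the automorphisms commuting with the Cartan
involution. -/
def groupK : Set AutG2 := {a | ∀ x, a (theta x) = theta (a x)}

/-- The parabolic subgroup `P_Θ`, the stabilizer of `p_Θ` in `G₂`. -/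
def groupP : Set AutG2 := {a | parabolic.map (a : SplitG2 →ₗ[ℝ] SplitG2) = parabolic}

/-- The isotropy group `K_Θ = K ∩ P_Θ` of the flag manifold `F_Θ = G₂ / P_Θ = K / K_Θ`. -/
def groupKTheta : Set AutG2 := groupK ∩ groupP

end SplitG2

open SplitG2

/-- The Lie algebra `k ≅ so(4)` of `K`: the fixed points of the Cartan involution. -/
def k : LieSubalgebra ℝ SplitG2 where
  carrier := {x | theta x = x}
  zero_mem' := map_zero theta
  add_mem' {x y} hx hy := by
    change theta x = x at hx
    change theta y = y at hy
    change theta (x + y) = x + y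
    rw [map_add, hx, hy]
  smul_mem' c x hx := by
    change theta x = x at hx
    change theta (c • x) = c • x
    rw [map_smul, hx]
  lie_mem' {x y} hx hy := by
    change theta x = x at hx
    change theta y = y at hy
    change theta ⁅x, y⁆ = ⁅x, y⁆
    rw [LieHom.map_lie, hx, hy]

theorem mem_k {x : SplitG2} : x ∈ k ↔ theta x = x := Iff.rfl

/-- The element `x₁X₁ + x₂X₂ + x₃X₃ + y₁Y₁ + y₂Y₂ + y₃Y₃` of `k`, where `X₁ = E₂₁ - E₁₂`,
`X₂ = E₃₁ - E₁₃`, `X₃ = E₃₂ - E₂₃`, `Yᵢ = eᵢ - εᵢ`. -/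
def kElem (x y : Fin 3 → ℝ) : k :=
  ⟨mk !![0, -x 0, -x 1; x 0, 0, -x 2; x 1, x 2, 0] (by simp [Matrix.trace_fin_three]) y (-y), by
    rw [mem_k]
    refine ext' ?_ ?_ ?_
    · ext i j
      fin_cases i <;> fin_cases j <;> simp
    · simp
    · simp⟩

/-- The isomorphism of `k` with `ℝ³ × ℝ³` given by the basis `X₁, X₂, X₃, Y₁, Y₂, Y₃`. -/
def kEquiv : k ≃ₗ[ℝ] (Fin 3 → ℝ) × (Fin 3 → ℝ) where
  toFun z := (![mat (z : SplitG2) 1 0, mat (z : SplitG2) 2 0, mat (z : SplitG2) 2 1],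
    vec (z : SplitG2))
  invFun p := kElem p.1 p.2
  map_add' z w := by
    refine Prod.ext ?_ ?_
    · ext i
      fin_cases i <;> simp
    · simp
  map_smul' c z := by
    refine Prod.ext ?_ ?_
    · ext i
      fin_cases i <;> simp
    · simp
  left_inv z := by
    have hz := mem_k.1 z.2
    have h₁ : -(mat (z : SplitG2))ᵀ = mat (z : SplitG2) := congrArg mat hz
    have h₂ : -vec (z : SplitG2) = cov (z : SplitG2) := congrArg cov hz
    have h (i j : Fin 3) : -mat (z : SplitG2) j i = mat (z : SplitG2) i j := congrFun₂ h₁ i j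
    refine Subtype.ext (ext' ?_ rfl h₂)
    ext i j
    have h00 := h 0 0
    have h11 := h 1 1
    have h22 := h 2 2
    have h01 := h 0 1
    have h02 := h 0 2
    have h12 := h 1 2
    fin_cases i <;> fin_cases j <;> simp [kElem] <;> linarith
  right_inv p := by
    refine Prod.ext ?_ ?_
    · ext i
      fin_cases i <;> simp [kElem]
    · simp [kElem]

@[simp] theorem kEquiv_kElem (x y : Fin 3 → ℝ) : kEquiv (kElem x y) = (x, y) :=
  kEquiv.right_inv (x, y)

@[simp] theorem kEquiv_symm (p : (Fin 3 → ℝ) × (Fin 3 → ℝ)) : kEquiv.symm p = kElem p.1 p.2 := rfl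

theorem kElem_kEquiv (z : k) : kElem (kEquiv z).1 (kEquiv z).2 = z := kEquiv.left_inv z

theorem kElem_lie (x y x' y' : Fin 3 → ℝ) : ⁅kElem x y, kElem x' y'⁆ = kElem
    ![x 1 * x' 2 - x 2 * x' 1 + 4 / 3 * (y 0 * y' 1 - y 1 * y' 0),
      x 2 * x' 0 - x 0 * x' 2 + 4 / 3 * (y 0 * y' 2 - y 2 * y' 0),
      x 0 * x' 1 - x 1 * x' 0 + 4 / 3 * (y 1 * y' 2 - y 2 * y' 1)]
    ![-(x 0 * y' 1 - y 1 * x' 0) - (x 1 * y' 2 - y 2 * x' 1) + 4 / 3 * (y 1 * y' 2 - y 2 * y' 1),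
      (x 0 * y' 0 - y 0 * x' 0) - (x 2 * y' 2 - y 2 * x' 2) - 4 / 3 * (y 0 * y' 2 - y 2 * y' 0),
      (x 1 * y' 0 - y 0 * x' 1) + (x 2 * y' 1 - y 1 * x' 2)
        + 4 / 3 * (y 0 * y' 1 - y 1 * y' 0)] := by
  refine Subtype.ext (ext' ?_ ?_ ?_)
  · ext i j
    rw [LieSubalgebra.coe_bracket, mat_lie_apply]
    fin_cases i <;> fin_cases j <;>
    · simp [kElem, tensor_apply]
      try ring
  · ext i
    rw [LieSubalgebra.coe_bracket, vec_lie_apply]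
    fin_cases i <;>
    · simp [kElem]
      try ring
  · ext i
    rw [LieSubalgebra.coe_bracket, cov_lie_apply]
    fin_cases i <;>
    · simp [kElem]
      try ring

theorem killingForm_kElem (x y x' y' : Fin 3 → ℝ) :
    killingForm ℝ k (kElem x y) (kElem x' y') =
      -4 * (x 0 * x' 0 + x 1 * x' 1 + x 2 * x' 2)
      - 80 / 9 * (y 0 * y' 0 + y 1 * y' 1 + y 2 * y' 2)
      - 8 / 3 * (x 0 * y' 2 + y 2 * x' 0) + 8 / 3 * (x 1 * y' 1 + y 1 * x' 1)
      - 8 / 3 * (x 2 * y' 0 + y 0 * x' 2) := by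
  let b : Module.Basis (Fin 3 ⊕ Fin 3) ℝ k :=
    ((Pi.basisFun ℝ (Fin 3)).prod (Pi.basisFun ℝ (Fin 3))).map kEquiv.symm
  have hl (i : Fin 3) : b (Sum.inl i) = kElem (Pi.single i 1) 0 := by simp [b]
  have hr (i : Fin 3) : b (Sum.inr i) = kElem 0 (Pi.single i 1) := by simp [b]
  have hrl (z : k) (i : Fin 3) : b.repr z (Sum.inl i) = (kEquiv z).1 i := by simp [b]
  have hrr (z : k) (i : Fin 3) : b.repr z (Sum.inr i) = (kEquiv z).2 i := by simp [b]
  rw [killingForm_apply_apply, LinearMap.trace_eq_matrix_trace ℝ b, Matrix.trace]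
  simp only [Matrix.diag_apply, LinearMap.toMatrix_apply, Fintype.sum_sum_type, hl, hr, hrl, hrr,
    LinearMap.comp_apply, LieAlgebra.ad_apply, kElem_lie, kEquiv_kElem, Fin.sum_univ_three]
  simp
  ring

namespace SplitG2

theorem mat_smul_apply (c : ℝ) (x : SplitG2) (i j : Fin 3) : mat (c • x) i j = c * mat x i j := by
  rw [map_smul]; rfl

theorem vec_smul_apply (c : ℝ) (x : SplitG2) (i : Fin 3) : vec (c • x) i = c * vec x i := by
  rw [map_smul]; rfl

theorem cov_smul_apply (c : ℝ) (x : SplitG2) (i : Fin 3) : cov (c • x) i = c * cov x i := by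
  rw [map_smul]; rfl

theorem cartan_lie_mat {h : SplitG2} (hh : h ∈ cartan) (x : SplitG2) (i j : Fin 3) :
    mat ⁅h, x⁆ i j = (mat h i i - mat h j j) * mat x i j := by
  obtain ⟨h₁, h₂, h₃⟩ := hh
  have h01 := h₁ 0 1 (by decide)
  have h02 := h₁ 0 2 (by decide)
  have h12 := h₁ 1 2 (by decide)
  have h10 := h₁ 1 0 (by decide)
  have h20 := h₁ 2 0 (by decide)
  have h21 := h₁ 2 1 (by decide)
  rw [mat_lie_apply, tensor_apply, tensor_apply, h₂, h₃]
  fin_cases i <;> fin_cases j <;> simp [h01, h02, h12, h10, h20, h21] <;> ring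

theorem cartan_lie_vec {h : SplitG2} (hh : h ∈ cartan) (x : SplitG2) (i : Fin 3) :
    vec ⁅h, x⁆ i = mat h i i * vec x i := by
  obtain ⟨h₁, h₂, h₃⟩ := hh
  have h01 := h₁ 0 1 (by decide)
  have h02 := h₁ 0 2 (by decide)
  have h12 := h₁ 1 2 (by decide)
  have h10 := h₁ 1 0 (by decide)
  have h20 := h₁ 2 0 (by decide)
  have h21 := h₁ 2 1 (by decide)
  rw [vec_lie_apply, h₂, h₃]
  fin_cases i <;> simp [h01, h02, h12, h10, h20, h21]

theorem cartan_lie_cov {h : SplitG2} (hh : h ∈ cartan) (x : SplitG2) (i : Fin 3) :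
    cov ⁅h, x⁆ i = -mat h i i * cov x i := by
  obtain ⟨h₁, h₂, h₃⟩ := hh
  have h01 := h₁ 0 1 (by decide)
  have h02 := h₁ 0 2 (by decide)
  have h12 := h₁ 1 2 (by decide)
  have h10 := h₁ 1 0 (by decide)
  have h20 := h₁ 2 0 (by decide)
  have h21 := h₁ 2 1 (by decide)
  rw [cov_lie_apply, h₂, h₃]
  fin_cases i <;> simp [h01, h02, h12, h10, h20, h21] <;> ring

/-- The subspace of all elements with `X` upper triangular, `v₃ = 0` and `α₁ = 0`. -/
def upper : Submodule ℝ SplitG2 where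
  carrier := {x | mat x 1 0 = 0 ∧ mat x 2 0 = 0 ∧ mat x 2 1 = 0 ∧ vec x 2 = 0 ∧ cov x 0 = 0}
  zero_mem' := by simp
  add_mem' := by
    rintro x y ⟨h₁, h₂, h₃, h₄, h₅⟩ ⟨h₁', h₂', h₃', h₄', h₅'⟩
    simp [h₁, h₂, h₃, h₄, h₅, h₁', h₂', h₃', h₄', h₅']
  smul_mem' := by
    rintro c x ⟨h₁, h₂, h₃, h₄, h₅⟩
    simp [h₁, h₂, h₃, h₄, h₅]

theorem rootSpace_le_upper (c : Fin 3 → ℝ)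
    (h₁ : c 0 + 3 * c 1 - 4 * c 2 ≠ 2) (h₂ : c 0 + 3 * c 1 - 4 * c 2 ≠ -5)
    (h₃ : c 0 + 3 * c 1 - 4 * c 2 ≠ -7) (h₄ : c 0 + 3 * c 1 - 4 * c 2 ≠ -4)
    (h₅ : c 0 + 3 * c 1 - 4 * c 2 ≠ -1) : rootSpace c ≤ upper := by
  intro x hx
  have hd : mk !![1, 0, 0; 0, 3, 0; 0, 0, -4] (by simp [Matrix.trace_fin_three]; norm_num) 0 0 ∈
      cartan := by
    refine ⟨fun i j hij => ?_, rfl, rfl⟩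
    fin_cases i <;> fin_cases j <;> simp at hij ⊢
  have hx' := hx _ hd
  have hm (i j : Fin 3) := congrFun₂ (congrArg mat hx') i j
  have hv (i : Fin 3) := congrFun (congrArg vec hx') i
  have hc (i : Fin 3) := congrFun (congrArg cov hx') i
  simp only [cartan_lie_mat hd, mat_smul_apply, Fin.sum_univ_three] at hm
  simp only [cartan_lie_vec hd, vec_smul_apply, Fin.sum_univ_three] at hv
  simp only [cartan_lie_cov hd, cov_smul_apply, Fin.sum_univ_three] at hc
  have e₁ := hm 1 0
  have e₂ := hm 2 0
  have e₃ := hm 2 1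
  have e₄ := hv 2
  have e₅ := hc 0
  simp at e₁ e₂ e₃ e₄ e₅
  refine ⟨?_, ?_, ?_, ?_, ?_⟩
  · exact e₁.resolve_left fun e => h₁ (by linarith)
  · exact e₂.resolve_left fun e => h₂ (by linarith)
  · exact e₃.resolve_left fun e => h₃ (by linarith)
  · exact (mul_eq_zero.1 (show (c 0 + 3 * c 1 - 4 * c 2 - -4) * vec x 2 = 0 by
      linarith)).resolve_left (sub_ne_zero.2 h₄)
  · exact (mul_eq_zero.1 (show (c 0 + 3 * c 1 - 4 * c 2 - -1) * cov x 0 = 0 by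
      linarith)).resolve_left (sub_ne_zero.2 h₅)

theorem parabolic_le_upper : parabolic ≤ upper := by
  refine sup_le (sup_le (sup_le (sup_le (sup_le (sup_le (sup_le ?_ ?_) ?_) ?_) ?_) ?_) ?_) ?_
  · rintro x ⟨h₁, h₂, h₃⟩
    exact ⟨h₁ _ _ (by decide), h₁ _ _ (by decide), h₁ _ _ (by decide), by simp [h₂], by simp [h₃]⟩
  all_goals
    apply rootSpace_le_upper <;> simp <;> norm_num

end SplitG2

/-- `k_Θ = k ∩ p_Θ`, the Lie algebra of `K_Θ`. -/
def kTheta : Submodule ℝ k := parabolic.comap k.toSubmodule.subtype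

theorem e2_mem : mk 0 (by simp) ![0, 1, 0] 0 ∈ rootSpace ![0, 1, 0] := by
  intro h hh
  refine ext' ?_ ?_ ?_
  · ext i j
    rw [cartan_lie_mat hh, mat_smul_apply]; simp
  · ext i
    rw [cartan_lie_vec hh, vec_smul_apply]
    fin_cases i <;> simp [Fin.sum_univ_three]
  · ext i
    rw [cartan_lie_cov hh, cov_smul_apply]; simp

theorem eps2_mem : mk 0 (by simp) 0 ![0, 1, 0] ∈ rootSpace ![0, -1, 0] := by
  intro h hh
  refine ext' ?_ ?_ ?_
  · ext i j
    rw [cartan_lie_mat hh, mat_smul_apply]; simp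
  · ext i
    rw [cartan_lie_vec hh, vec_smul_apply]; simp
  · ext i
    rw [cartan_lie_cov hh, cov_smul_apply]
    fin_cases i <;> simp [Fin.sum_univ_three]

theorem kTheta_eq : kTheta = Submodule.span ℝ {kElem 0 ![0, 1, 0]} := by
  apply le_antisymm
  · intro z hz
    have hu : (z : SplitG2) ∈ upper := parabolic_le_upper (Submodule.mem_comap.1 hz)
    obtain ⟨h₁, h₂, h₃, h₄, h₅⟩ := hu
    rw [Submodule.mem_span_singleton]
    refine ⟨(kEquiv z).2 1, ?_⟩
    have hz' := congrArg cov (mem_k.1 z.2)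
    have h6 : -vec (z : SplitG2) 0 = cov (z : SplitG2) 0 := congrFun hz' 0
    apply kEquiv.injective
    rw [map_smul, kEquiv_kElem]
    refine Prod.ext ?_ ?_
    · ext i
      fin_cases i
      · exact (by simpa [kEquiv] using h₁.symm)
      · exact (by simpa [kEquiv] using h₂.symm)
      · exact (by simpa [kEquiv] using h₃.symm)
    · ext i
      fin_cases i
      · have : vec (z : SplitG2) 0 = 0 := by
          change cov (z : SplitG2) 0 = 0 at h₅
          linarith
        exact (by simpa [kEquiv] using this.symm)
      · simp [kEquiv]
      · exact (by simpa [kEquiv] using h₄.symm)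
  · rw [Submodule.span_le, Set.singleton_subset_iff]
    change (kElem 0 ![0, 1, 0] : SplitG2) ∈ parabolic
    have h : (kElem 0 ![0, 1, 0] : SplitG2) =
        mk 0 (by simp) ![0, 1, 0] 0 - mk 0 (by simp) 0 ![0, 1, 0] := by
      refine ext' ?_ ?_ ?_
      · rw [map_sub]
        ext i j
        fin_cases i <;> fin_cases j <;> simp [kElem]
      · rw [map_sub]; simp [kElem]
      · rw [map_sub]; simp [kElem]
    rw [h]
    refine sub_mem ?_ ?_
    · exact Submodule.mem_sup_left (Submodule.mem_sup_left (Submodule.mem_sup_right e2_mem))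
    · exact Submodule.mem_sup_right eps2_mem

/-- `m_Θ`, the orthogonal complement of `k_Θ` in `k` for the Killing form of `k`. -/
def mTheta : Submodule ℝ k := (killingForm ℝ k).orthogonal kTheta

theorem isCompl_mTheta : IsCompl mTheta kTheta := by
  rw [mTheta, kTheta_eq]
  refine (LinearMap.BilinForm.isCompl_span_singleton_orthogonal ?_).symm
  rw [killingForm_kElem]
  simp

theorem kElem_mem_mTheta {x y : Fin 3 → ℝ} (h : 3 * x 1 = 10 * y 1) : kElem x y ∈ mTheta := by
  rw [mTheta, kTheta_eq, LinearMap.BilinForm.mem_orthogonal_iff]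
  intro z hz
  obtain ⟨c, rfl⟩ := Submodule.mem_span_singleton.1 hz
  rw [map_smul, LinearMap.smul_apply, killingForm_kElem]
  simp
  right
  linarith

/-- The bracket `[X, Y]_m`: the component in `m_Θ` of `[X, Y]` along `k = m_Θ ⊕ k_Θ`. -/
def bracketM : mTheta →ₗ[ℝ] mTheta →ₗ[ℝ] mTheta :=
  LinearMap.mk₂ ℝ
    (fun X Y => mTheta.projectionOnto kTheta isCompl_mTheta ⁅(X : k), (Y : k)⁆)
    (by intro X X' Y; simp) (by intro c X Y; simp) (by intro X Y Y'; simp) (by intro c X Y; simp)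

/-- The adjoint action of an element of `K` on `k`. -/
def adK (a : AutG2) (ha : a ∈ groupK) : k ≃ₗ⁅ℝ⁆ k :=
  LieEquiv.ofSubalgebras k k a (by
    ext x
    rw [LieSubalgebra.mem_map]
    constructor
    · rintro ⟨y, hy, rfl⟩
      rw [mem_k] at hy ⊢
      have h := ha y
      rw [hy] at h
      exact h.symm
    · intro hx
      rw [mem_k] at hx
      refine ⟨a.symm x, ?_, a.apply_symm_apply x⟩
      rw [mem_k]
      apply a.injective
      have h := ha (a.symm x)
      rw [a.apply_symm_apply, hx] at h
      exact h.trans (a.apply_symm_apply x).symm)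

theorem coe_adK (a : AutG2) (ha : a ∈ groupK) (z : k) : (adK a ha z : SplitG2) = a z := rfl

theorem mem_groupK {a : AutG2} (ha : a ∈ groupKTheta) : a ∈ groupK := ha.1

/-- The isotropy representation `Ad : K_Θ → GL(m_Θ)`. -/
def adM (a : AutG2) (ha : a ∈ groupKTheta) : mTheta →ₗ[ℝ] mTheta :=
  LinearMap.restrict (adK a (mem_groupK ha) : k →ₗ[ℝ] k) (by
    intro X hX
    change ∀ n ∈ kTheta, _ at hX
    change ∀ n ∈ kTheta, _
    intro n hn
    have hn' : (n : SplitG2) ∈ parabolic.map (a : SplitG2 →ₗ[ℝ] SplitG2) := by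
      rw [show parabolic.map (a : SplitG2 →ₗ[ℝ] SplitG2) = parabolic from ha.2]
      exact hn
    obtain ⟨y, hy, hyn⟩ := hn'
    have hy2 : ((adK a (mem_groupK ha)).symm n : SplitG2) = y := by
      apply a.injective
      change ((adK a (mem_groupK ha) ((adK a (mem_groupK ha)).symm n) : k) : SplitG2) = _
      rw [LieEquiv.apply_symm_apply]
      exact hyn.symm
    have hmem : (adK a (mem_groupK ha)).symm n ∈ kTheta := by
      change ((adK a (mem_groupK ha)).symm n : SplitG2) ∈ parabolic
      rw [hy2]
      exact hy
    have h := hX _ hmem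
    change killingForm ℝ k n (adK a (mem_groupK ha) X) = 0
    rw [← (adK a (mem_groupK ha)).apply_symm_apply n, LieAlgebra.killingForm_of_equiv_apply]
    exact h)

theorem coe_adM (a : AutG2) (ha : a ∈ groupKTheta) (X : mTheta) :
    ((adM a ha X : k) : SplitG2) = a ((X : k) : SplitG2) := rfl

/-! ### Invariant metrics and the Ricci tensor -/

/-- `g` is an `Ad(K_Θ)`-invariant inner product on `m_Θ`, that is, a `K`-invariant Riemannian
metric on `F_Θ = K / K_Θ`. -/
structure IsInvariantMetric (g : LinearMap.BilinForm ℝ mTheta) : Prop where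
  symm : ∀ X Y, g X Y = g Y X
  pos : ∀ X, X ≠ 0 → 0 < g X X
  invariant : ∀ (a : AutG2) (ha : a ∈ groupKTheta) (X Y : mTheta),
    g (adM a ha X) (adM a ha Y) = g X Y

/-- `A` is the metric operator of `g`: `g(X, Y) = (AX, Y)`, where `(·, ·)` is the negative of the
Killing form of `k`. -/
def IsMetricOperator (g : LinearMap.BilinForm ℝ mTheta) (A : mTheta →ₗ[ℝ] mTheta) : Prop :=
  ∀ X Y : mTheta, g X Y = -killingForm ℝ k (A X : k) (Y : k)

/-- The irreducible summands `m₁ = span {10 X₂ + 3 Y₂}`, `m₂ = span {2 X₁ + 3 Y₃, 2 X₃ + 3 Y₁}`,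
`m₃ = span {2 X₁ - Y₃, 2 X₃ - Y₁}` of the isotropy representation. -/
def summand : Fin 3 → Submodule ℝ mTheta :=
  ![Submodule.span ℝ {⟨kElem ![0, 10, 0] ![0, 3, 0], kElem_mem_mTheta (by simp; norm_num)⟩},
    Submodule.span ℝ {⟨kElem ![2, 0, 0] ![0, 0, 3], kElem_mem_mTheta (by simp)⟩,
      ⟨kElem ![0, 0, 2] ![3, 0, 0], kElem_mem_mTheta (by simp)⟩},
    Submodule.span ℝ {⟨kElem ![2, 0, 0] ![0, 0, -1], kElem_mem_mTheta (by simp)⟩,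
      ⟨kElem ![0, 0, 2] ![-1, 0, 0], kElem_mem_mTheta (by simp)⟩}]

/-- `v` is a `g`-orthonormal basis of `m_Θ`. -/
def IsOrthonormal {ι : Type*} [DecidableEq ι] (g : LinearMap.BilinForm ℝ mTheta)
    (v : Module.Basis ι ℝ mTheta) : Prop :=
  ∀ i j, g (v i) (v j) = if i = j then 1 else 0

/-- The map `U` with `2 g(U(X, Y), W) = g([W, X]_m, Y) + g([W, Y]_m, X)`, expanded in a
`g`-orthonormal basis `v`. -/
def mapU {ι : Type*} [Fintype ι] (g : LinearMap.BilinForm ℝ mTheta)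
    (v : Module.Basis ι ℝ mTheta) (X Y : mTheta) : mTheta :=
  ∑ i, ((1 / 2 : ℝ) * (g (bracketM (v i) X) Y + g (bracketM (v i) Y) X)) • v i

/-- The Ricci tensor of the invariant metric `g` at the origin of `K / K_Θ`, written in a
`g`-orthonormal basis `v` of `m_Θ`. -/
def ricciFormula {ι : Type*} [Fintype ι] (g : LinearMap.BilinForm ℝ mTheta)
    (v : Module.Basis ι ℝ mTheta) (X Y : mTheta) : ℝ :=
  -(1 / 2) * ∑ i, g (bracketM X (v i)) (bracketM Y (v i))
  - (1 / 2) * killingForm ℝ k (X : k) (Y : k)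
  + (1 / 4) * ∑ i, ∑ j, g (bracketM (v i) (v j)) X * g (bracketM (v i) (v j)) Y
  - g (mapU g v X Y) (∑ i, mapU g v (v i) (v i))

open Classical in
/-- The Ricci tensor of the invariant metric `g`, computed in some `g`-orthonormal basis; it does
not depend on the basis, see `ricci_eq`. -/
def ricci (g : LinearMap.BilinForm ℝ mTheta) (X Y : mTheta) : ℝ :=
  if h : ∃ v : Module.Basis (Fin (Module.finrank ℝ mTheta)) ℝ mTheta, IsOrthonormal g v then
    ricciFormula g h.choose X Y
  else 0

theorem IsOrthonormal.symm_form {ι : Type*} [DecidableEq ι] {g : LinearMap.BilinForm ℝ mTheta} {v : Module.Basis ι ℝ mTheta}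
    (hv : IsOrthonormal g v) (X Y : mTheta) : g X Y = g Y X := by
  have h : g = g.flip := LinearMap.BilinForm.ext_basis v fun i j => by
    change _ = g (v j) (v i)
    rw [hv, hv]
    simp only [eq_comm]
  exact LinearMap.congr_fun₂ h X Y

section Independence

variable {ι κ : Type*} [Fintype ι] [DecidableEq ι] [Fintype κ] [DecidableEq κ]

theorem IsOrthonormal.expand {g : LinearMap.BilinForm ℝ mTheta} {v : Module.Basis ι ℝ mTheta}
    (hv : IsOrthonormal g v) (X : mTheta) : X = ∑ i, g X (v i) • v i := by
  have h (i : ι) : g X (v i) = v.repr X i := by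
    conv_lhs => rw [← v.sum_repr X]
    rw [map_sum, LinearMap.sum_apply]
    simp only [map_smul, LinearMap.smul_apply, hv _ i]
    simp
  simp only [h, v.sum_repr]

theorem IsOrthonormal.sum_eq {P : Type*} [AddCommGroup P] [Module ℝ P]
    {g : LinearMap.BilinForm ℝ mTheta} {v : Module.Basis ι ℝ mTheta}
    {w : Module.Basis κ ℝ mTheta} (hv : IsOrthonormal g v) (hw : IsOrthonormal g w)
    (f : mTheta →ₗ[ℝ] mTheta →ₗ[ℝ] P) : ∑ i, f (v i) (v i) = ∑ j, f (w j) (w j) := by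
  calc ∑ i, f (v i) (v i) = ∑ i, ∑ j, g (v i) (w j) • f (w j) (v i) := by
        refine Finset.sum_congr rfl fun i _ => ?_
        conv_lhs => rw [show f (v i) = f (∑ j, g (v i) (w j) • w j) by rw [← hw.expand]]
        simp
    _ = ∑ j, f (w j) (∑ i, g (w j) (v i) • v i) := by
        rw [Finset.sum_comm]
        refine Finset.sum_congr rfl fun j _ => ?_
        simp [hv.symm_form (w j)]
    _ = ∑ j, f (w j) (w j) := by
        refine Finset.sum_congr rfl fun j _ => ?_
        rw [← hv.expand]

theorem mapU_eq {g : LinearMap.BilinForm ℝ mTheta} {v : Module.Basis ι ℝ mTheta}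
    {w : Module.Basis κ ℝ mTheta} (hv : IsOrthonormal g v) (hw : IsOrthonormal g w)
    (X Y : mTheta) : mapU g v X Y = mapU g w X Y := by
  let φ : mTheta →ₗ[ℝ] ℝ :=
    (1 / 2 : ℝ) • (g.flip Y ∘ₗ bracketM.flip X + g.flip X ∘ₗ bracketM.flip Y)
  exact hv.sum_eq hw (LinearMap.lsmul ℝ mTheta ∘ₗ φ)

theorem ricciFormula_eq {g : LinearMap.BilinForm ℝ mTheta} {v : Module.Basis ι ℝ mTheta}
    {w : Module.Basis κ ℝ mTheta} (hv : IsOrthonormal g v) (hw : IsOrthonormal g w)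
    (X Y : mTheta) : ricciFormula g v X Y = ricciFormula g w X Y := by
  have h₁ : ∑ i, g (bracketM X (v i)) (bracketM Y (v i)) =
      ∑ i, g (bracketM X (w i)) (bracketM Y (w i)) :=
    hv.sum_eq hw (g.compl₁₂ (bracketM X) (bracketM Y))
  have h₂ : ∑ i, ∑ j, g (bracketM (v i) (v j)) X * g (bracketM (v i) (v j)) Y =
      ∑ i, ∑ j, g (bracketM (w i) (w j)) X * g (bracketM (w i) (w j)) Y := by
    calc _ = ∑ i, ∑ j, g (bracketM (v i) (w j)) X * g (bracketM (v i) (w j)) Y :=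
          Finset.sum_congr rfl fun i _ => hv.sum_eq hw ((LinearMap.mul ℝ ℝ).compl₁₂
            (g.flip X ∘ₗ bracketM (v i)) (g.flip Y ∘ₗ bracketM (v i)))
      _ = ∑ j, ∑ i, g (bracketM (v i) (w j)) X * g (bracketM (v i) (w j)) Y := Finset.sum_comm
      _ = ∑ j, ∑ i, g (bracketM (w i) (w j)) X * g (bracketM (w i) (w j)) Y :=
          Finset.sum_congr rfl fun j _ => hv.sum_eq hw ((LinearMap.mul ℝ ℝ).compl₁₂
            (g.flip X ∘ₗ bracketM.flip (w j)) (g.flip Y ∘ₗ bracketM.flip (w j)))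
      _ = _ := Finset.sum_comm
  have h₃ : ∑ i, mapU g v (v i) (v i) = ∑ i, mapU g w (w i) (w i) := by
    simp only [mapU_eq hv hw]
    refine hv.sum_eq hw (LinearMap.mk₂ ℝ (mapU g w) ?_ ?_ ?_ ?_)
    · intro X X' Y
      simp only [mapU, map_add, LinearMap.add_apply, ← Finset.sum_add_distrib, ← add_smul]
      refine Finset.sum_congr rfl fun i _ => ?_
      congr 1
      ring
    · intro c X Y
      simp only [mapU, map_smul, LinearMap.smul_apply, Finset.smul_sum, smul_smul, smul_eq_mul]
      refine Finset.sum_congr rfl fun i _ => ?_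
      congr 1
      ring
    · intro X Y Y'
      simp only [mapU, map_add, LinearMap.add_apply, ← Finset.sum_add_distrib, ← add_smul]
      refine Finset.sum_congr rfl fun i _ => ?_
      congr 1
      ring
    · intro c X Y
      simp only [mapU, map_smul, LinearMap.smul_apply, Finset.smul_sum, smul_smul, smul_eq_mul]
      refine Finset.sum_congr rfl fun i _ => ?_
      congr 1
      ring
  rw [ricciFormula, ricciFormula, h₁, h₂, h₃, mapU_eq hv hw]

/-- The Ricci tensor is given by the formula in every orthonormal basis. -/
theorem ricci_eq {g : LinearMap.BilinForm ℝ mTheta} {v : Module.Basis ι ℝ mTheta}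
    (hv : IsOrthonormal g v) (X Y : mTheta) : ricci g X Y = ricciFormula g v X Y := by
  have h : ∃ w : Module.Basis (Fin (Module.finrank ℝ mTheta)) ℝ mTheta, IsOrthonormal g w := by
    have e : ι ≃ Fin (Module.finrank ℝ mTheta) :=
      Fintype.equivFinOfCardEq (Module.finrank_eq_card_basis v).symm
    refine ⟨v.reindex e, fun i j => ?_⟩
    rw [v.reindex_apply, v.reindex_apply, hv]
    simp
  rw [ricci, dif_pos h]
  exact ricciFormula_eq h.choose_spec hv X Y

end Independence

/-! ### The homogeneous Ricci flow -/

/-- The time interval `[0, T)` for `T ∈ [-∞, ∞]`. -/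
def timeInterval (T : EReal) : Set ℝ := {t | 0 ≤ t ∧ (t : EReal) < T}

/-- `g` is a solution of the homogeneous Ricci flow `dg/dt = -2 Ric(g)` on `[0, T)`, through
invariant metrics on `F_Θ`. -/
structure IsRicciFlow (g : ℝ → LinearMap.BilinForm ℝ mTheta) (T : EReal) : Prop where
  invariant : ∀ t ∈ timeInterval T, IsInvariantMetric (g t)
  flow : ∀ t ∈ timeInterval T, ∀ X Y : mTheta,
    HasDerivWithinAt (fun s => g s X Y) (-2 * ricci (g t) X Y) (timeInterval T) t

/-- A solution on `[0, T)` that does not extend to a solution on a longer interval `[0, T')`. -/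
def IsMaximalRicciFlow (g : ℝ → LinearMap.BilinForm ℝ mTheta) (T : EReal) : Prop :=
  IsRicciFlow g T ∧ ∀ (g' : ℝ → LinearMap.BilinForm ℝ mTheta) (T' : EReal), IsRicciFlow g' T' →
    (∀ t ∈ timeInterval T, g' t = g t) → T' ≤ T

end

end G2Flag

/-!
The isotropy group contains the circle `exp (ℝ ad Y₂)`, which acts on `m₁`, `m₂`, `m₃` with weights
`0`, `2`, `2/3`. An invariant metric is therefore `xᵢ` times the negative of the Killing form on the
`i`-th summand, with the indices `0, 1, 2` for `m₁, m₂, m₃`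
(`IsInvariantMetric.exists_diagMetric`); one explicit rotation of the circle is enough for this.
Conversely all such metrics are invariant under the whole isotropy group, since an isotropy element
maps `Y₂` to `± Y₂` and a diagonal metric is a polynomial in `(ad Y₂)²` relative to the Killing form
(`isInvariantMetric_diagMetric`).

In `k = so(4) = su(2) ⊕ su(2)` the planes `m₂` and `m₃` are root planes of the two factors for the
torus `m₁ ⊕ k_Θ`, so the flag manifold is a circle bundle over `S² × S²` with fibre direction `m₁`,
and the flow (`ricci_diagMetric`) is the system
`x₀' = -(u² + 9 w²) / 20`, `x₁' = -1 + u / 20`, `x₂' = -1 + 9 w / 20`, where `u = x₀ / x₁` and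
`w = x₀ / x₂`.

The functions `x₀`, `x₀ + x₁ + t / 2` and `x₀ + x₂` do not increase. Hence the flow ends at a finite
time (`IsDiagFlowOn.exists_eq_coe`) and all `xᵢ` have limits there (`IsDiagFlowOn.exists_limit`).
If `x₁` and `x₂` both had positive limits, then so would `x₀`, because `(1 / x₀)'` would be bounded
(`IsDiagFlowOn.limit_zero_pos`), and the solution could be continued
(`IsDiagFlowOn.exists_extension`), against maximality. So `x₁` or `x₂` tends to `0`. If `x₀` had a
positive limit, that function would have a positive derivative near the end of the flow and could
not tend to `0` (`IsDiagFlowOn.limit_one_ne_zero`, `IsDiagFlowOn.limit_two_ne_zero`); so `x₀` tends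
to `0` as well.
-/

namespace G2Flag

open scoped Matrix

noncomputable section

/-! ### Coordinates on the isotropy representation -/

theorem mem_mTheta_iff {z : k} : z ∈ mTheta ↔ 3 * (kEquiv z).1 1 = 10 * (kEquiv z).2 1 := by
  refine ⟨fun hz => ?_, fun h => kElem_kEquiv z ▸ kElem_mem_mTheta h⟩
  rw [mTheta, kTheta_eq, LinearMap.BilinForm.mem_orthogonal_iff] at hz
  have h := hz _ (Submodule.mem_span_singleton_self _)
  rw [← kElem_kEquiv z, killingForm_kElem] at h
  simp at h
  linarith

/-- The coordinates on `m_Θ` in the basis `10 X₂ + 3 Y₂`, `2 X₁ + 3 Y₃`, `2 X₃ + 3 Y₁`,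
`2 X₁ - Y₃`, `2 X₃ - Y₁`, as an isomorphism from `ℝ⁵`. -/
def coordEquiv : (Fin 5 → ℝ) ≃ₗ[ℝ] mTheta where
  toFun c := ⟨kElem ![2 * c 1 + 2 * c 3, 10 * c 0, 2 * c 2 + 2 * c 4]
    ![3 * c 2 - c 4, 3 * c 0, 3 * c 1 - c 3], kElem_mem_mTheta (by simp; ring)⟩
  map_add' c d := by
    refine Subtype.ext (kEquiv.injective ?_)
    rw [Submodule.coe_add, map_add]
    simp only [kEquiv_kElem]
    refine Prod.ext ?_ ?_ <;> ext i <;> fin_cases i <;> simp <;> ring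
  map_smul' r c := by
    refine Subtype.ext (kEquiv.injective ?_)
    rw [Submodule.coe_smul, map_smul]
    simp only [kEquiv_kElem]
    refine Prod.ext ?_ ?_ <;> ext i <;> fin_cases i <;> simp <;> ring
  invFun z := ![(kEquiv z).1 1 / 10, ((kEquiv z).1 0 + 2 * (kEquiv z).2 2) / 8,
    ((kEquiv z).1 2 + 2 * (kEquiv z).2 0) / 8, (3 * (kEquiv z).1 0 - 2 * (kEquiv z).2 2) / 8,
    (3 * (kEquiv z).1 2 - 2 * (kEquiv z).2 0) / 8]
  left_inv c := by
    simp only [kEquiv_kElem]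
    ext i; fin_cases i <;> simp <;> ring
  right_inv z := by
    have h := mem_mTheta_iff.1 z.2
    refine Subtype.ext (kEquiv.injective ?_)
    simp only [kEquiv_kElem]
    refine Prod.ext ?_ ?_ <;> ext i <;> fin_cases i <;> simp <;> linarith

theorem coe_coordEquiv (c : Fin 5 → ℝ) : (coordEquiv c : k) =
    kElem ![2 * c 1 + 2 * c 3, 10 * c 0, 2 * c 2 + 2 * c 4]
      ![3 * c 2 - c 4, 3 * c 0, 3 * c 1 - c 3] := rfl

theorem killingForm_coordEquiv (c d : Fin 5 → ℝ) :
    killingForm ℝ k (coordEquiv c : k) (coordEquiv d : k) =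
      -(320 * (c 0 * d 0) + 128 * (c 1 * d 1 + c 2 * d 2)
        + 128 / 9 * (c 3 * d 3 + c 4 * d 4)) := by
  rw [coe_coordEquiv, coe_coordEquiv, killingForm_kElem]
  simp
  ring

theorem bracketM_apply (X Y : mTheta) :
    bracketM X Y = mTheta.projectionOnto kTheta isCompl_mTheta ⁅(X : k), (Y : k)⁆ := rfl

theorem kElem_mem_kTheta (r : ℝ) : kElem 0 ![0, r, 0] ∈ kTheta := by
  rw [kTheta_eq, Submodule.mem_span_singleton]
  refine ⟨r, kEquiv.injective ?_⟩
  rw [map_smul, kEquiv_kElem, kEquiv_kElem]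
  refine Prod.ext ?_ ?_ <;> ext i <;> fin_cases i <;> simp

/-- The bracket of `m_Θ` in coordinates. The planes `m₂` and `m₃` are root planes of the two
factors of `so(4) = su(2) ⊕ su(2)` for the torus `m₁ ⊕ k_Θ`, so they commute. -/
theorem bracketM_coordEquiv (c d : Fin 5 → ℝ) : bracketM (coordEquiv c) (coordEquiv d) =
    coordEquiv ![-(8 / 5) * (c 1 * d 2 - c 2 * d 1) - 8 / 15 * (c 3 * d 4 - c 4 * d 3),
      4 * (c 0 * d 2 - c 2 * d 0), -4 * (c 0 * d 1 - c 1 * d 0),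
      12 * (c 0 * d 4 - c 4 * d 0), -12 * (c 0 * d 3 - c 3 * d 0)] := by
  set e : Fin 5 → ℝ := _
  change _ = coordEquiv e
  have h : ⁅(coordEquiv c : k), (coordEquiv d : k)⁆ = (coordEquiv e : k) +
      kElem 0 ![0, 144 / 5 * (c 1 * d 2 - c 2 * d 1) - 16 / 15 * (c 3 * d 4 - c 4 * d 3), 0] := by
    rw [coe_coordEquiv, coe_coordEquiv, coe_coordEquiv, kElem_lie]
    apply kEquiv.injective
    rw [map_add, kEquiv_kElem, kEquiv_kElem, kEquiv_kElem]
    refine Prod.ext ?_ ?_ <;> ext i <;> fin_cases i <;> simp [e] <;> ring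
  rw [bracketM_apply, h, map_add,
    (Submodule.projectionOnto_apply_eq_zero_iff isCompl_mTheta).2 (kElem_mem_kTheta _),
    Submodule.projectionOnto_apply_left, add_zero]

/-- The diagonal metric that is `xᵢ` times the negative of the Killing form on `mᵢ`. -/
def diagMetric (x : Fin 3 → ℝ) : LinearMap.BilinForm ℝ mTheta :=
  LinearMap.mk₂ ℝ (fun X Y =>
      320 * x 0 * (coordEquiv.symm X 0 * coordEquiv.symm Y 0)
      + 128 * x 1 * (coordEquiv.symm X 1 * coordEquiv.symm Y 1
        + coordEquiv.symm X 2 * coordEquiv.symm Y 2)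
      + 128 / 9 * x 2 * (coordEquiv.symm X 3 * coordEquiv.symm Y 3
        + coordEquiv.symm X 4 * coordEquiv.symm Y 4))
    (by intro X X' Y; simp only [map_add, Pi.add_apply]; ring)
    (by intro c X Y; simp only [map_smul, Pi.smul_apply, smul_eq_mul]; ring)
    (by intro X Y Y'; simp only [map_add, Pi.add_apply]; ring)
    (by intro c X Y; simp only [map_smul, Pi.smul_apply, smul_eq_mul]; ring)

theorem diagMetric_coordEquiv (x : Fin 3 → ℝ) (c d : Fin 5 → ℝ) :
    diagMetric x (coordEquiv c) (coordEquiv d) = 320 * x 0 * (c 0 * d 0)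
      + 128 * x 1 * (c 1 * d 1 + c 2 * d 2) + 128 / 9 * x 2 * (c 3 * d 3 + c 4 * d 4) := by
  simp [diagMetric]

/-! ### A rotation in the isotropy group -/

namespace SplitG2

/-- The `sl(3)`-component of `rotLin`. -/
def rotMat (c s : ℝ) (x : SplitG2) : Matrix (Fin 3) (Fin 3) ℝ :=
    !![mat x 0 0 + ((1 - (c ^ 2 - s ^ 2)) * mat x 1 1 - 4 / 3 * (c * s) * (vec x 1 + cov x 1)) / 2,
      c ^ 3 * mat x 0 1 + 2 * c ^ 2 * s * vec x 0 - 2 * c * s ^ 2 * cov x 2 + s ^ 3 * mat x 1 2,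
      mat x 0 2;
      c ^ 3 * mat x 1 0 + 2 * c ^ 2 * s * cov x 0 - 2 * c * s ^ 2 * vec x 2 + s ^ 3 * mat x 2 1,
      (c ^ 2 - s ^ 2) * mat x 1 1 + 4 / 3 * (c * s) * (vec x 1 + cov x 1),
      -s ^ 3 * mat x 0 1 + 2 * c * s ^ 2 * vec x 0 + 2 * c ^ 2 * s * cov x 2 + c ^ 3 * mat x 1 2;
      mat x 2 0,
      -s ^ 3 * mat x 1 0 + 2 * c * s ^ 2 * cov x 0 + 2 * c ^ 2 * s * vec x 2 + c ^ 3 * mat x 2 1,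
      mat x 2 2 + ((1 - (c ^ 2 - s ^ 2)) * mat x 1 1
        - 4 / 3 * (c * s) * (vec x 1 + cov x 1)) / 2]

/-- The `ℝ³`-component of `rotLin`. -/
def rotVec (c s : ℝ) (x : SplitG2) : Fin 3 → ℝ :=
    ![-(3 / 2) * c ^ 2 * s * mat x 0 1 + (c ^ 3 - 2 * c * s ^ 2) * vec x 0
        + (s ^ 3 - 2 * c ^ 2 * s) * cov x 2 + 3 / 2 * c * s ^ 2 * mat x 1 2,
      (vec x 1 - cov x 1) / 2 + (c ^ 2 - s ^ 2) * ((vec x 1 + cov x 1) / 2)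
        - 3 / 2 * (c * s) * mat x 1 1,
      -(3 / 2) * c * s ^ 2 * mat x 1 0 + (2 * c ^ 2 * s - s ^ 3) * cov x 0
        + (c ^ 3 - 2 * c * s ^ 2) * vec x 2 - 3 / 2 * c ^ 2 * s * mat x 2 1]

/-- The `(ℝ³)*`-component of `rotLin`. -/
def rotCov (c s : ℝ) (x : SplitG2) : Fin 3 → ℝ :=
    ![-(3 / 2) * c ^ 2 * s * mat x 1 0 + (c ^ 3 - 2 * c * s ^ 2) * cov x 0
        + (s ^ 3 - 2 * c ^ 2 * s) * vec x 2 + 3 / 2 * c * s ^ 2 * mat x 2 1,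
      -((vec x 1 - cov x 1) / 2) + (c ^ 2 - s ^ 2) * ((vec x 1 + cov x 1) / 2)
        - 3 / 2 * (c * s) * mat x 1 1,
      -(3 / 2) * c * s ^ 2 * mat x 0 1 + (2 * c ^ 2 * s - s ^ 3) * vec x 0
        + (c ^ 3 - 2 * c * s ^ 2) * cov x 2 - 3 / 2 * c ^ 2 * s * mat x 1 2]

/-- The linear map `exp (t ad Z)` for `Z = (3 / 2) (e₂ - ε₂)`, `c = cos t` and `s = sin t`. Under
the `sl(2)` of the root `α₂` the two four-dimensional summands, spanned by `E₁₂, e₁, ε₃, E₂₃` and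
by `E₂₁, ε₁, e₃, E₃₂`, are binary cubics, the summand spanned by `e₂, ε₂, [e₂, ε₂]` is the adjoint
representation, and `E₁₃, E₃₁, E₁₁ - E₃₃` are fixed. -/
def rotLin (c s : ℝ) : SplitG2 →ₗ[ℝ] SplitG2 where
  toFun x := mk (rotMat c s x)
    (by rw [Matrix.trace_fin_three]; simp [rotMat, mat_two_two]; ring) (rotVec c s x) (rotCov c s x)
  map_add' x y := by
    refine ext' ?_ ?_ ?_
    · ext i j; fin_cases i <;> fin_cases j <;> simp [rotMat] <;> ring
    · ext i; fin_cases i <;> simp [rotVec] <;> ring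
    · ext i; fin_cases i <;> simp [rotCov] <;> ring
  map_smul' r x := by
    refine ext' ?_ ?_ ?_
    · ext i j; fin_cases i <;> fin_cases j <;> simp [rotMat] <;> ring
    · ext i; fin_cases i <;> simp [rotVec] <;> ring
    · ext i; fin_cases i <;> simp [rotCov] <;> ring

theorem mat_rotLin (c s : ℝ) (x : SplitG2) : mat (rotLin c s x) = rotMat c s x := rfl

theorem vec_rotLin (c s : ℝ) (x : SplitG2) : vec (rotLin c s x) = rotVec c s x := rfl

theorem cov_rotLin (c s : ℝ) (x : SplitG2) : cov (rotLin c s x) = rotCov c s x := rfl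

theorem rotLin_theta (c s : ℝ) (x : SplitG2) : rotLin c s (theta x) = theta (rotLin c s x) := by
  refine ext' ?_ ?_ ?_
  · rw [mat_theta, mat_rotLin, mat_rotLin]
    ext i j; fin_cases i <;> fin_cases j <;> simp [rotMat] <;> ring
  · rw [vec_theta, vec_rotLin, cov_rotLin]
    ext i; fin_cases i <;> simp [rotVec, rotCov] <;> ring
  · rw [cov_theta, vec_rotLin, cov_rotLin]
    ext i; fin_cases i <;> simp [rotVec, rotCov] <;> ring

theorem rotLin_mem_upper (c s : ℝ) {x : SplitG2} (hx : x ∈ upper) : rotLin c s x ∈ upper := by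
  obtain ⟨h₁, h₂, h₃, h₄, h₅⟩ := hx
  refine ⟨?_, ?_, ?_, ?_, ?_⟩ <;>
    simp [mat_rotLin, vec_rotLin, cov_rotLin, rotMat, rotVec, rotCov, h₁, h₂, h₃, h₄, h₅]

theorem rotLin_rotLin {c s : ℝ} (h : c = 3 / 5) (hs : s ^ 2 = 16 / 25) (x : SplitG2) :
    rotLin c (-s) (rotLin c s x) = x := by
  have h₄ : s ^ 4 = 256 / 625 := by rw [show s ^ 4 = (s ^ 2) ^ 2 by ring, hs]; norm_num
  have h₆ : s ^ 6 = 4096 / 15625 := by rw [show s ^ 6 = (s ^ 2) ^ 3 by ring, hs]; norm_num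
  refine ext' ?_ ?_ ?_
  · rw [mat_rotLin]
    ext i j
    fin_cases i <;> fin_cases j <;>
    simp [mat_rotLin, vec_rotLin, cov_rotLin, rotMat, rotVec, rotCov, h] <;> ring_nf <;>
    simp only [hs, h₄, h₆] <;> ring
  · rw [vec_rotLin]
    ext i
    fin_cases i <;>
    simp [mat_rotLin, vec_rotLin, cov_rotLin, rotMat, rotVec, rotCov, h] <;> ring_nf <;>
    simp only [hs, h₄, h₆] <;> ring
  · rw [cov_rotLin]
    ext i
    fin_cases i <;>
    simp [mat_rotLin, vec_rotLin, cov_rotLin, rotMat, rotVec, rotCov, h] <;> ring_nf <;>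
    simp only [hs, h₄, h₆] <;> ring

theorem rotLin_neg_rotLin (x : SplitG2) :
    rotLin (3 / 5) (-(4 / 5)) (rotLin (3 / 5) (4 / 5) x) = x :=
  rotLin_rotLin rfl (by norm_num) x

theorem rotLin_rotLin_neg (x : SplitG2) :
    rotLin (3 / 5) (4 / 5) (rotLin (3 / 5) (-(4 / 5)) x) = x := by
  simpa using rotLin_rotLin (c := 3 / 5) (s := -(4 / 5)) rfl (by norm_num) x

set_option maxHeartbeats 4000000 in
theorem rotLin_lie (x y : SplitG2) : rotLin (3 / 5) (4 / 5) ⁅x, y⁆ =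
    ⁅rotLin (3 / 5) (4 / 5) x, rotLin (3 / 5) (4 / 5) y⁆ := by
  refine ext' ?_ ?_ ?_
  · rw [mat_rotLin]
    ext i j
    rw [mat_lie_apply, tensor_apply, tensor_apply]
    simp only [mat_rotLin, vec_rotLin, cov_rotLin]
    fin_cases i <;> fin_cases j <;>
    · simp [rotMat, rotVec, rotCov, mat_lie_apply, vec_lie_apply, cov_lie_apply, tensor_apply,
        mat_two_two]
      ring
  · rw [vec_rotLin]
    ext i
    rw [vec_lie_apply]
    simp only [mat_rotLin, vec_rotLin, cov_rotLin]
    fin_cases i <;>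
    · simp [rotMat, rotVec, rotCov, mat_lie_apply, vec_lie_apply, cov_lie_apply, tensor_apply,
        mat_two_two]
      ring
  · rw [cov_rotLin]
    ext i
    rw [cov_lie_apply]
    simp only [mat_rotLin, vec_rotLin, cov_rotLin]
    fin_cases i <;>
    · simp [rotMat, rotVec, rotCov, mat_lie_apply, vec_lie_apply, cov_lie_apply, tensor_apply,
        mat_two_two]
      ring

/-- The automorphism `exp (t ad Z)` for `cos t = 3 / 5` and `sin t = 4 / 5`. -/
def rotAut : AutG2 :=
  { rotLin (3 / 5) (4 / 5) with
    map_lie' := fun {x y} => rotLin_lie x y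
    invFun := rotLin (3 / 5) (-(4 / 5))
    left_inv := rotLin_neg_rotLin
    right_inv := rotLin_rotLin_neg }

theorem rotAut_apply (x : SplitG2) : rotAut x = rotLin (3 / 5) (4 / 5) x := rfl

theorem parabolic_eq_upper : parabolic = upper := by
  refine le_antisymm parabolic_le_upper fun x hx => ?_
  obtain ⟨h₁, h₂, h₃, h₄, h₅⟩ := hx
  have hroot (M : Matrix (Fin 3) (Fin 3) ℝ) (hM : M.trace = 0) (v α c : Fin 3 → ℝ)
      (hm : ∀ h ∈ cartan, ∀ i j, (mat h i i - mat h j j) * M i j =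
        (∑ i, c i * mat h i i) * M i j)
      (hv : ∀ h ∈ cartan, ∀ i, mat h i i * v i = (∑ i, c i * mat h i i) * v i)
      (hα : ∀ h ∈ cartan, ∀ i, -mat h i i * α i = (∑ i, c i * mat h i i) * α i) :
      mk M hM v α ∈ rootSpace c := by
    intro h hh
    refine ext' ?_ ?_ ?_
    · ext i j
      rw [cartan_lie_mat hh, mat_smul_apply]
      exact hm h hh i j
    · ext i
      rw [cartan_lie_vec hh, vec_smul_apply]
      exact hv h hh i
    · ext i
      rw [cartan_lie_cov hh, cov_smul_apply]
      exact hα h hh i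
  have e₀ : mk !![mat x 0 0, 0, 0; 0, mat x 1 1, 0; 0, 0, mat x 2 2]
      (by rw [Matrix.trace_fin_three]; simp [mat_two_two]) 0 0 ∈ cartan := by
    refine ⟨fun i j hij => ?_, rfl, rfl⟩
    fin_cases i <;> fin_cases j <;> simp at hij ⊢
  have e₁ : mk !![0, mat x 0 1, 0; 0, 0, 0; 0, 0, 0] (by simp [Matrix.trace_fin_three]) 0 0 ∈
      rootSpace ![1, -1, 0] := by
    apply hroot
    · intro h _ i j
      fin_cases i <;> fin_cases j <;> simp [Fin.sum_univ_three]
      ring_nf; simp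
    · simp
    · simp
  have e₂ : mk !![0, 0, mat x 0 2; 0, 0, 0; 0, 0, 0] (by simp [Matrix.trace_fin_three]) 0 0 ∈
      rootSpace ![1, 0, -1] := by
    apply hroot
    · intro h _ i j
      fin_cases i <;> fin_cases j <;> simp [Fin.sum_univ_three]
      ring_nf; simp
    · simp
    · simp
  have e₃ : mk !![0, 0, 0; 0, 0, mat x 1 2; 0, 0, 0] (by simp [Matrix.trace_fin_three]) 0 0 ∈
      rootSpace ![0, 1, -1] := by
    apply hroot
    · intro h _ i j
      fin_cases i <;> fin_cases j <;> simp [Fin.sum_univ_three]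
      ring_nf; simp
    · simp
    · simp
  have e₄ : mk 0 (by simp) ![vec x 0, 0, 0] 0 ∈ rootSpace ![1, 0, 0] := by
    apply hroot
    · simp
    · intro h _ i
      fin_cases i <;> simp [Fin.sum_univ_three]
    · simp
  have e₅ : mk 0 (by simp) ![0, vec x 1, 0] 0 ∈ rootSpace ![0, 1, 0] := by
    apply hroot
    · simp
    · intro h _ i
      fin_cases i <;> simp [Fin.sum_univ_three]
    · simp
  have e₆ : mk 0 (by simp) 0 ![0, 0, cov x 2] ∈ rootSpace ![0, 0, -1] := by
    apply hroot
    · simp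
    · simp
    · intro h _ i
      fin_cases i <;> simp [Fin.sum_univ_three]
  have e₇ : mk 0 (by simp) 0 ![0, cov x 1, 0] ∈ rootSpace ![0, -1, 0] := by
    apply hroot
    · simp
    · simp
    · intro h _ i
      fin_cases i <;> simp [Fin.sum_univ_three]
  have key := Submodule.add_mem_sup (Submodule.add_mem_sup (Submodule.add_mem_sup
    (Submodule.add_mem_sup (Submodule.add_mem_sup (Submodule.add_mem_sup
    (Submodule.add_mem_sup e₀ e₁) e₂) e₃) e₄) e₅) e₆) e₇
  change x ∈ _
  refine Eq.mp (congrArg (· ∈ _) ?_) key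
  symm
  refine ext' ?_ ?_ ?_
  · simp only [map_add, mat_mk]
    ext i j
    fin_cases i <;> fin_cases j <;> simp [h₁, h₂, h₃]
  · simp only [map_add, vec_mk]
    ext i
    fin_cases i <;> simp [h₄]
  · simp only [map_add, cov_mk]
    ext i
    fin_cases i <;> simp [h₅]

theorem rotAut_mem : rotAut ∈ groupKTheta := by
  refine ⟨rotLin_theta _ _, ?_⟩
  change parabolic.map _ = parabolic
  rw [parabolic_eq_upper]
  apply le_antisymm
  · rintro _ ⟨x, hx, rfl⟩
    exact rotLin_mem_upper _ _ hx
  · intro x hx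
    exact ⟨_, rotLin_mem_upper _ _ hx, rotLin_rotLin_neg x⟩

end SplitG2

open SplitG2

theorem kEquiv_apply (z : k) : kEquiv z =
    (![mat (z : SplitG2) 1 0, mat (z : SplitG2) 2 0, mat (z : SplitG2) 2 1],
      vec (z : SplitG2)) := rfl

/-- On `m₁`, `m₂`, `m₃` the rotation acts as rotation by `0`, `3t` and `t`, where `cos t = 3 / 5`
and `sin t = 4 / 5`. -/
theorem adM_rotAut (c : Fin 5 → ℝ) : adM rotAut rotAut_mem (coordEquiv c) =
    coordEquiv ![c 0, -(117 / 125) * c 1 - 44 / 125 * c 2, 44 / 125 * c 1 - 117 / 125 * c 2,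
      3 / 5 * c 3 + 4 / 5 * c 4, -(4 / 5) * c 3 + 3 / 5 * c 4] := by
  refine Subtype.ext (kEquiv.injective ?_)
  rw [coe_coordEquiv, kEquiv_kElem, kEquiv_apply, coe_adM, rotAut_apply, mat_rotLin, vec_rotLin,
    coe_coordEquiv]
  refine Prod.ext ?_ ?_ <;> ext i <;> fin_cases i <;> simp [rotMat, rotVec, kElem] <;> ring

/-! ### Invariant metrics are diagonal -/

theorem coordEquiv_eq_sum (c : Fin 5 → ℝ) :
    coordEquiv c = ∑ i, c i • coordEquiv (Pi.single i 1) := by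
  simp only [← map_smul, ← map_sum]
  congr 1
  ext i
  simp [Finset.sum_apply, Pi.single_apply]

theorem bilin_coordEquiv (g : LinearMap.BilinForm ℝ mTheta) (c d : Fin 5 → ℝ) :
    g (coordEquiv c) (coordEquiv d) =
      ∑ i, ∑ j, c i * (d j * g (coordEquiv (Pi.single i 1)) (coordEquiv (Pi.single j 1))) := by
  rw [coordEquiv_eq_sum c, coordEquiv_eq_sum d]
  simp only [map_sum, map_smul, LinearMap.sum_apply, LinearMap.smul_apply, smul_eq_mul,
    Finset.mul_sum]
  rw [Finset.sum_comm]
  exact Finset.sum_congr rfl fun i _ => Finset.sum_congr rfl fun j _ => by ring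

/-- Invariance under the single element `rotAut` already forces an inner product to be diagonal: it
acts on `m₁`, `m₂`, `m₃` by rotation through angles `0`, `3t`, `t`, no two of which agree up to sign
modulo `2π`, and `3t` and `t` are not multiples of `π`. -/
theorem IsInvariantMetric.exists_diagMetric {g : LinearMap.BilinForm ℝ mTheta}
    (hg : IsInvariantMetric g) : ∃ x : Fin 3 → ℝ, (∀ i, 0 < x i) ∧ g = diagMetric x := by
  obtain ⟨G, hG⟩ : ∃ G : Fin 5 → Fin 5 → ℝ, ∀ i j,
    g (coordEquiv (Pi.single i 1)) (coordEquiv (Pi.single j 1)) = G i j := ⟨_, fun _ _ => rfl⟩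
  have hs (i j : Fin 5) : G i j = G j i := by rw [← hG, ← hG, hg.symm]
  have hinv (i j : Fin 5) := hg.invariant rotAut rotAut_mem (coordEquiv (Pi.single i 1))
    (coordEquiv (Pi.single j 1))
  simp only [adM_rotAut, hG] at hinv
  have hexp (c d : Fin 5 → ℝ) :
      g (coordEquiv c) (coordEquiv d) = ∑ i, ∑ j, c i * (d j * G i j) := by
    simp only [bilin_coordEquiv g c d, hG]
  have hinv' (i j : Fin 5) := (hexp _ _).symm.trans (hinv i j)
  simp only [Fin.sum_univ_five] at hinv'
  have hpos (i : Fin 5) : 0 < G i i := by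
    rw [← hG]
    refine hg.pos _ fun h => ?_
    have := congrFun (coordEquiv.map_eq_zero_iff.1 h) i
    simp at this
  have i01 := hinv' 0 1
  have i02 := hinv' 0 2
  have i03 := hinv' 0 3
  have i04 := hinv' 0 4
  have i11 := hinv' 1 1
  have i12 := hinv' 1 2
  have i13 := hinv' 1 3
  have i14 := hinv' 1 4
  have i23 := hinv' 2 3
  have i24 := hinv' 2 4
  have i33 := hinv' 3 3
  have i34 := hinv' 3 4
  simp at i01 i02 i03 i04 i11 i12 i13 i14 i23 i24 i33 i34
  have s21 := hs 2 1
  have s43 := hs 4 3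
  have e01 : G 0 1 = 0 := by linarith only [i01, i02]
  have e02 : G 0 2 = 0 := by linarith only [i01, i02]
  have e03 : G 0 3 = 0 := by linarith only [i03, i04]
  have e04 : G 0 4 = 0 := by linarith only [i03, i04]
  have e12 : G 1 2 = 0 := by linarith only [i11, i12, s21]
  have e22 : G 2 2 = G 1 1 := by linarith only [i11, i12, s21]
  have e34 : G 3 4 = 0 := by linarith only [i33, i34, s43]
  have e44 : G 4 4 = G 3 3 := by linarith only [i33, i34, s43]
  have e13 : G 1 3 = 0 := by linarith only [i13, i14, i23, i24]
  have e14 : G 1 4 = 0 := by linarith only [i13, i14, i23, i24]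
  have e23 : G 2 3 = 0 := by linarith only [i13, i14, i23, i24]
  have e24 : G 2 4 = 0 := by linarith only [i13, i14, i23, i24]
  refine ⟨![G 0 0 / 320, G 1 1 / 128, G 3 3 * 9 / 128], fun i => ?_, ?_⟩
  · have h0 := hpos 0
    have h1 := hpos 1
    have h3 := hpos 3
    fin_cases i
    · exact div_pos h0 (by norm_num)
    · exact div_pos h1 (by norm_num)
    · exact div_pos (mul_pos h3 (by norm_num)) (by norm_num)
  · refine LinearMap.ext₂ fun X Y => ?_
    obtain ⟨c, rfl⟩ := coordEquiv.surjective X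
    obtain ⟨d, rfl⟩ := coordEquiv.surjective Y
    rw [diagMetric_coordEquiv, hexp]
    simp only [Fin.sum_univ_five, hs 1 0, hs 2 0, hs 3 0, hs 4 0, hs 3 1, hs 4 1, hs 3 2, hs 4 2,
      s21, s43, e01, e02, e03, e04, e12, e13, e14, e23, e24, e22, e34, e44]
    simp
    ring

theorem coe_bracket_bracket (c : Fin 5 → ℝ) :
    ⁅kElem 0 ![0, 1, 0], ⁅kElem 0 ![0, 1, 0], (coordEquiv c : k)⁆⁆ =
      (coordEquiv ![0, -4 * c 1, -4 * c 2, -(4 / 9) * c 3, -(4 / 9) * c 4] : k) := by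
  rw [coe_coordEquiv, coe_coordEquiv, kElem_lie, kElem_lie]
  apply kEquiv.injective
  rw [kEquiv_kElem, kEquiv_kElem]
  refine Prod.ext ?_ ?_ <;> ext i <;> fin_cases i <;> simp <;> ring

/-- The square of `ad Y₂` has the distinct eigenvalues `0`, `-4`, `-4/9` on `m₁`, `m₂`, `m₃`, so a
diagonal metric is a polynomial in it with respect to the Killing form. -/
theorem exists_diagMetric_eq_killingForm (x : Fin 3 → ℝ) : ∃ α β γ : ℝ, ∀ X Y : mTheta,
    diagMetric x X Y = α * killingForm ℝ k (X : k) (Y : k)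
      + β * killingForm ℝ k ⁅kElem 0 ![0, 1, 0], ⁅kElem 0 ![0, 1, 0], (X : k)⁆⁆ (Y : k)
      + γ * killingForm ℝ k ⁅kElem 0 ![0, 1, 0], ⁅kElem 0 ![0, 1, 0], (X : k)⁆⁆
          ⁅kElem 0 ![0, 1, 0], ⁅kElem 0 ![0, 1, 0], (Y : k)⁆⁆ := by
  -- The coefficients solve `-(α + β r + γ r²) = xᵢ` for the three eigenvalues `r`.
  refine ⟨-x 0, 9 / 32 * (9 * x 2 - x 1 - 8 * x 0) - (x 0 - x 1) / 4,
    9 / 128 * (9 * x 2 - x 1 - 8 * x 0), fun X Y => ?_⟩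
  obtain ⟨c, rfl⟩ := coordEquiv.surjective X
  obtain ⟨d, rfl⟩ := coordEquiv.surjective Y
  rw [diagMetric_coordEquiv, coe_bracket_bracket, coe_bracket_bracket, killingForm_coordEquiv,
    killingForm_coordEquiv, killingForm_coordEquiv]
  simp
  ring

/-- An element of `K_Θ` maps `Y₂` to `Y₂` or `-Y₂`. -/
theorem adK_Y {a : AutG2} (ha : a ∈ groupKTheta) : ∃ r : ℝ, r * r = 1 ∧
    adK a (mem_groupK ha) (kElem 0 ![0, 1, 0]) = r • kElem 0 ![0, 1, 0] := by
  have hmem : adK a (mem_groupK ha) (kElem 0 ![0, 1, 0]) ∈ kTheta := by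
    change (adK a (mem_groupK ha) (kElem 0 ![0, 1, 0]) : SplitG2) ∈ parabolic
    rw [← show parabolic.map (a : SplitG2 →ₗ[ℝ] SplitG2) = parabolic from ha.2]
    exact ⟨_, kElem_mem_kTheta 1, rfl⟩
  rw [kTheta_eq, Submodule.mem_span_singleton] at hmem
  obtain ⟨r, hr⟩ := hmem
  refine ⟨r, ?_, hr.symm⟩
  have h := LieAlgebra.killingForm_of_equiv_apply (adK a (mem_groupK ha)) (kElem 0 ![0, 1, 0])
    (kElem 0 ![0, 1, 0])
  rw [← hr, map_smul, map_smul, LinearMap.smul_apply, killingForm_kElem] at h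
  simp at h
  linarith

/-- The isotropy group preserves the Killing form and, as it maps `Y₂` to `± Y₂`, commutes with the
square of `ad Y₂`; a diagonal metric is built from these two. -/
theorem isInvariantMetric_diagMetric {x : Fin 3 → ℝ} (hx : ∀ i, 0 < x i) :
    IsInvariantMetric (diagMetric x) where
  symm X Y := by
    obtain ⟨c, rfl⟩ := coordEquiv.surjective X
    obtain ⟨d, rfl⟩ := coordEquiv.surjective Y
    rw [diagMetric_coordEquiv, diagMetric_coordEquiv]
    ring
  pos X hX := by
    obtain ⟨c, rfl⟩ := coordEquiv.surjective X
    rw [diagMetric_coordEquiv]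
    have h0 := hx 0
    have h1 := hx 1
    have h2 := hx 2
    by_contra hle
    apply hX
    have q0 : 0 ≤ 320 * x 0 * (c 0 * c 0) :=
      mul_nonneg (by positivity) (mul_self_nonneg _)
    have q1 : 0 ≤ 128 * x 1 * (c 1 * c 1) :=
      mul_nonneg (by positivity) (mul_self_nonneg _)
    have q2 : 0 ≤ 128 * x 1 * (c 2 * c 2) :=
      mul_nonneg (by positivity) (mul_self_nonneg _)
    have q3 : 0 ≤ 128 / 9 * x 2 * (c 3 * c 3) :=
      mul_nonneg (by positivity) (mul_self_nonneg _)
    have q4 : 0 ≤ 128 / 9 * x 2 * (c 4 * c 4) :=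
      mul_nonneg (by positivity) (mul_self_nonneg _)
    have z0 : 320 * x 0 * (c 0 * c 0) = 0 := by linarith
    have z1 : 128 * x 1 * (c 1 * c 1) = 0 := by linarith
    have z2 : 128 * x 1 * (c 2 * c 2) = 0 := by linarith
    have z3 : 128 / 9 * x 2 * (c 3 * c 3) = 0 := by linarith
    have z4 : 128 / 9 * x 2 * (c 4 * c 4) = 0 := by linarith
    simp [h0.ne'] at z0
    simp [h1.ne'] at z1 z2
    simp [h2.ne'] at z3 z4
    rw [show c = 0 by ext i; fin_cases i <;> simp [z0, z1, z2, z3, z4], map_zero]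
  invariant a ha X Y := by
    obtain ⟨α, β, γ, h⟩ := exists_diagMetric_eq_killingForm x
    obtain ⟨r, hr, hY⟩ := adK_Y ha
    have hadM (X : mTheta) : (adM a ha X : k) = adK a (mem_groupK ha) X := rfl
    have hcomm (z : k) :
        ⁅kElem 0 ![0, 1, 0], ⁅kElem 0 ![0, 1, 0], adK a (mem_groupK ha) z⁆⁆ =
          adK a (mem_groupK ha) ⁅kElem 0 ![0, 1, 0], ⁅kElem 0 ![0, 1, 0], z⁆⁆ := by
      rw [LieEquiv.map_lie, LieEquiv.map_lie, hY, smul_lie, smul_lie, lie_smul, smul_smul, hr,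
        one_smul]
    rw [h, h, hadM, hadM, hcomm, hcomm, LieAlgebra.killingForm_of_equiv_apply,
      LieAlgebra.killingForm_of_equiv_apply, LieAlgebra.killingForm_of_equiv_apply]

/-! ### The Ricci tensor of a diagonal metric -/

/-- The coefficients of the Ricci tensor of the diagonal metric `x` with respect to the negative of
the Killing form on `m₁`, `m₂`, `m₃`. -/
def ricciCoeff (x : Fin 3 → ℝ) : Fin 3 → ℝ :=
  ![((x 0 / x 1) ^ 2 + 9 * (x 0 / x 2) ^ 2) / 40, (1 - (x 0 / x 1) / 20) / 2,
    (1 - 9 * (x 0 / x 2) / 20) / 2]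

/-- The squared lengths of the coordinate vectors for the diagonal metric `x`. -/
def normSq (x : Fin 3 → ℝ) : Fin 5 → ℝ :=
  ![320 * x 0, 128 * x 1, 128 * x 1, 128 / 9 * x 2, 128 / 9 * x 2]

theorem normSq_pos {x : Fin 3 → ℝ} (hx : ∀ i, 0 < x i) (i : Fin 5) : 0 < normSq x i := by
  have h0 := hx 0
  have h1 := hx 1
  have h2 := hx 2
  fin_cases i <;> simp [normSq] <;> assumption

/-- The normalized coordinate vectors form an orthonormal basis of a diagonal metric. -/
theorem exists_isOrthonormal_diagMetric {x : Fin 3 → ℝ} (hx : ∀ i, 0 < x i) :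
    ∃ (v : Module.Basis (Fin 5) ℝ mTheta) (s : Fin 5 → ℝ), IsOrthonormal (diagMetric x) v ∧
      (∀ i, v i = s i • coordEquiv (Pi.single i 1)) ∧ ∀ i, s i * s i = (normSq x i)⁻¹ := by
  have hs (i : Fin 5) : (√(normSq x i))⁻¹ * (√(normSq x i))⁻¹ = (normSq x i)⁻¹ := by
    rw [← mul_inv, Real.mul_self_sqrt (normSq_pos hx i).le]
  have hu (i : Fin 5) : IsUnit (√(normSq x i))⁻¹ :=
    (inv_ne_zero (Real.sqrt_pos.2 (normSq_pos hx i)).ne').isUnit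
  refine ⟨((Pi.basisFun ℝ (Fin 5)).map coordEquiv).isUnitSMul hu, fun i => (√(normSq x i))⁻¹,
    fun i j => ?_, fun i => ?_, hs⟩
  · simp only [Module.Basis.isUnitSMul_apply, Module.Basis.map_apply, Pi.basisFun_apply, map_smul,
      LinearMap.smul_apply, smul_eq_mul, diagMetric_coordEquiv]
    split_ifs with hij
    · subst hij
      rw [← mul_assoc, hs, inv_mul_eq_one₀ (normSq_pos hx i).ne']
      fin_cases i <;> simp [normSq]
    · fin_cases i <;> fin_cases j <;> simp at hij ⊢
  · rw [Module.Basis.isUnitSMul_apply, Module.Basis.map_apply, Pi.basisFun_apply]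

theorem ricci_diagMetric {x : Fin 3 → ℝ} (hx : ∀ i, 0 < x i) (X Y : mTheta) :
    ricci (diagMetric x) X Y = diagMetric (ricciCoeff x) X Y := by
  obtain ⟨v, s, hv, hvs, hs⟩ := exists_isOrthonormal_diagMetric hx
  have h0 := (hx 0).ne'
  have h1 := (hx 1).ne'
  have h2 := (hx 2).ne'
  -- No bracket `[w, v i]` has a component along `v i`, so the trace of `U` vanishes.
  have hU (i : Fin 5) : mapU (diagMetric x) v (v i) (v i) = 0 := by
    refine Finset.sum_eq_zero fun j _ => ?_
    rw [hvs, hvs]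
    simp only [map_smul, LinearMap.smul_apply, bracketM_coordEquiv, diagMetric_coordEquiv]
    fin_cases i <;> fin_cases j <;> simp
  obtain ⟨c, rfl⟩ := coordEquiv.surjective X
  obtain ⟨d, rfl⟩ := coordEquiv.surjective Y
  have e₁ (i : Fin 5) : diagMetric x (bracketM (coordEquiv c) (v i))
      (bracketM (coordEquiv d) (v i)) =
      (normSq x i)⁻¹ * diagMetric x (bracketM (coordEquiv c) (coordEquiv (Pi.single i 1)))
        (bracketM (coordEquiv d) (coordEquiv (Pi.single i 1))) := by
    rw [hvs, ← hs]
    simp only [map_smul, LinearMap.smul_apply, smul_eq_mul]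
    ring
  have e₂ (i j : Fin 5) : diagMetric x (bracketM (v i) (v j)) (coordEquiv c) *
      diagMetric x (bracketM (v i) (v j)) (coordEquiv d) =
      (normSq x i)⁻¹ * (normSq x j)⁻¹ *
      (diagMetric x (bracketM (coordEquiv (Pi.single i 1)) (coordEquiv (Pi.single j 1)))
        (coordEquiv c) *
      diagMetric x (bracketM (coordEquiv (Pi.single i 1)) (coordEquiv (Pi.single j 1)))
        (coordEquiv d)) := by
    rw [hvs, hvs, ← hs, ← hs]
    simp only [map_smul, LinearMap.smul_apply, smul_eq_mul]
    ring
  rw [ricci_eq hv, ricciFormula, Finset.sum_eq_zero fun i _ => hU i, map_zero, sub_zero,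
    Finset.sum_congr rfl fun i _ => e₁ i,
    Finset.sum_congr rfl fun i _ => Finset.sum_congr rfl fun j _ => e₂ i j,
    killingForm_coordEquiv, diagMetric_coordEquiv]
  simp only [bracketM_coordEquiv, diagMetric_coordEquiv, Fin.sum_univ_five]
  simp [normSq, ricciCoeff]
  field_simp
  ring

/-! ### The metric operator of a diagonal metric -/

theorem diagMetric_one (X Y : mTheta) :
    diagMetric (fun _ => 1) X Y = -killingForm ℝ k (X : k) (Y : k) := by
  obtain ⟨c, rfl⟩ := coordEquiv.surjective X
  obtain ⟨d, rfl⟩ := coordEquiv.surjective Y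
  rw [diagMetric_coordEquiv, killingForm_coordEquiv]
  ring

theorem summand_le (i : Fin 3) : summand i ≤ Submodule.span ℝ
    ((fun j => coordEquiv (Pi.single j 1)) '' {j : Fin 5 | ![0, 1, 1, 2, 2] j = i}) := by
  have h (j : Fin 5) (z : mTheta) (hz : (z : k) = (coordEquiv (Pi.single j 1) : k)) :
      z ∈ (fun j => coordEquiv (Pi.single j 1)) '' {l : Fin 5 | ![(0 : Fin 3), 1, 1, 2, 2] l =
        ![0, 1, 1, 2, 2] j} := ⟨j, rfl, (Subtype.ext hz).symm⟩
  fin_cases i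
  · refine Submodule.span_mono ?_
    rintro _ rfl
    exact h 0 _ (by simp [coe_coordEquiv])
  · refine Submodule.span_mono ?_
    rintro _ (rfl | rfl)
    · exact h 1 _ (by simp [coe_coordEquiv])
    · exact h 2 _ (by simp [coe_coordEquiv])
  · refine Submodule.span_mono ?_
    rintro _ (rfl | rfl)
    · exact h 3 _ (by simp [coe_coordEquiv])
    · exact h 4 _ (by simp [coe_coordEquiv])

theorem diagMetric_of_mem_summand (x : Fin 3 → ℝ) {i : Fin 3} {X : mTheta} (hX : X ∈ summand i)
    (Y : mTheta) : diagMetric x X Y = x i * diagMetric (fun _ => 1) X Y := by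
  have h : Set.EqOn ((diagMetric x).flip Y) (x i • (diagMetric fun _ => 1).flip Y : mTheta →ₗ[ℝ] ℝ)
      ((fun j => coordEquiv (Pi.single j 1)) '' {j : Fin 5 | ![0, 1, 1, 2, 2] j = i}) := by
    rintro _ ⟨j, hj, rfl⟩
    obtain ⟨d, rfl⟩ := coordEquiv.surjective Y
    obtain rfl := hj
    change diagMetric x (coordEquiv (Pi.single j 1)) (coordEquiv d) = x (![0, 1, 1, 2, 2] j) *
      diagMetric (fun _ => 1) (coordEquiv (Pi.single j 1)) (coordEquiv d)
    rw [diagMetric_coordEquiv, diagMetric_coordEquiv]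
    fin_cases j <;> simp <;> ring
  exact LinearMap.eqOn_span h (summand_le i hX)

theorem IsMetricOperator.apply_of_mem_summand {x : Fin 3 → ℝ} {A : mTheta →ₗ[ℝ] mTheta}
    (hA : IsMetricOperator (diagMetric x) A) {i : Fin 3} {X : mTheta} (hX : X ∈ summand i) :
    A X = x i • X := by
  by_contra hne
  have hpos := (isInvariantMetric_diagMetric (x := fun _ => 1) fun _ => one_pos).pos _
    (sub_ne_zero.2 hne)
  have h := hA X (A X - x i • X)
  rw [diagMetric_of_mem_summand x hX, ← diagMetric_one] at h
  rw [LinearMap.map_sub₂, LinearMap.map_smul₂, smul_eq_mul, ← h, sub_self] at hpos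
  exact lt_irrefl _ hpos

/-! ### The Ricci flow as a system of ordinary differential equations -/

/-- `x` is a positive solution on `S` of the system to which the Ricci flow of diagonal metrics
reduces. -/
def IsDiagFlowOn (x : ℝ → Fin 3 → ℝ) (S : Set ℝ) : Prop :=
  ∀ t ∈ S, (∀ i, 0 < x t i) ∧ HasDerivWithinAt x (fun i => -2 * ricciCoeff (x t) i) S t

theorem IsRicciFlow.exists_isDiagFlowOn {g : ℝ → LinearMap.BilinForm ℝ mTheta} {T : EReal}
    (hg : IsRicciFlow g T) : ∃ x : ℝ → Fin 3 → ℝ, IsDiagFlowOn x (timeInterval T) ∧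
      ∀ t ∈ timeInterval T, g t = diagMetric (x t) := by
  have h (t : ℝ) : ∃ x : Fin 3 → ℝ, t ∈ timeInterval T → (∀ i, 0 < x i) ∧ g t = diagMetric x := by
    by_cases ht : t ∈ timeInterval T
    · obtain ⟨x, hx⟩ := (hg.invariant t ht).exists_diagMetric
      exact ⟨x, fun _ => hx⟩
    · exact ⟨0, fun h => absurd h ht⟩
  choose x hx using h
  refine ⟨x, fun t ht => ⟨(hx t ht).1, hasDerivWithinAt_pi.2 fun i => ?_⟩, fun t ht => (hx t ht).2⟩
  obtain ⟨j, hj⟩ : ∃ j : Fin 5, ![(0 : Fin 3), 1, 1, 2, 2] j = i := by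
    fin_cases i
    exacts [⟨0, rfl⟩, ⟨1, rfl⟩, ⟨3, rfl⟩]
  have hd (y : Fin 3 → ℝ) : diagMetric y (coordEquiv (Pi.single j 1)) (coordEquiv (Pi.single j 1)) =
      normSq (fun _ => 1) j * y i := by
    subst hj
    rw [diagMetric_coordEquiv]
    fin_cases j <;> simp [normSq]
  have hn := (normSq_pos (x := fun _ => 1) (fun _ => one_pos) j).ne'
  have hflow := (hg.flow t ht (coordEquiv (Pi.single j 1)) (coordEquiv (Pi.single j 1))).const_mul
    (normSq (fun _ => 1) j)⁻¹
  rw [(hx t ht).2, ricci_diagMetric (hx t ht).1, hd] at hflow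
  have hcongr (s : ℝ) (hs : s ∈ timeInterval T) : x s i = (normSq (fun _ => 1) j)⁻¹ *
      g s (coordEquiv (Pi.single j 1)) (coordEquiv (Pi.single j 1)) := by
    rw [(hx s hs).2, hd, inv_mul_cancel_left₀ hn]
  refine (hflow.congr hcongr (hcongr t ht)).congr_deriv ?_
  field_simp

theorem IsDiagFlowOn.isRicciFlow {x : ℝ → Fin 3 → ℝ} {T : EReal}
    (hx : IsDiagFlowOn x (timeInterval T)) : IsRicciFlow (fun t => diagMetric (x t)) T where
  invariant t ht := isInvariantMetric_diagMetric (hx t ht).1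
  flow t ht X Y := by
    obtain ⟨c, rfl⟩ := coordEquiv.surjective X
    obtain ⟨d, rfl⟩ := coordEquiv.surjective Y
    rw [ricci_diagMetric (hx t ht).1]
    simp only [diagMetric_coordEquiv]
    have h := hasDerivWithinAt_pi.1 (hx t ht).2
    refine (((((h 0).const_mul 320).mul_const (c 0 * d 0)).add
      (((h 1).const_mul 128).mul_const (c 1 * d 1 + c 2 * d 2))).add
      (((h 2).const_mul (128 / 9)).mul_const (c 3 * d 3 + c 4 * d 4))).congr_deriv ?_
    ring

namespace IsDiagFlowOn

variable {x : ℝ → Fin 3 → ℝ} {S : Set ℝ}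

theorem mono (hx : IsDiagFlowOn x S) {S' : Set ℝ} (h : S' ⊆ S) : IsDiagFlowOn x S' :=
  fun t ht => ⟨(hx t (h ht)).1, (hx t (h ht)).2.mono h⟩

theorem hasDerivWithinAt_zero (hx : IsDiagFlowOn x S) {t : ℝ} (ht : t ∈ S) :
    HasDerivWithinAt (fun s => x s 0)
      (-((x t 0 / x t 1) ^ 2 + 9 * (x t 0 / x t 2) ^ 2) / 20) S t :=
  (hasDerivWithinAt_pi.1 (hx t ht).2 0).congr_deriv (by simp [ricciCoeff]; ring)

theorem hasDerivWithinAt_one (hx : IsDiagFlowOn x S) {t : ℝ} (ht : t ∈ S) :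
    HasDerivWithinAt (fun s => x s 1) (-1 + x t 0 / x t 1 / 20) S t :=
  (hasDerivWithinAt_pi.1 (hx t ht).2 1).congr_deriv (by simp [ricciCoeff]; ring)

theorem hasDerivWithinAt_two (hx : IsDiagFlowOn x S) {t : ℝ} (ht : t ∈ S) :
    HasDerivWithinAt (fun s => x s 2) (-1 + 9 * (x t 0 / x t 2) / 20) S t :=
  (hasDerivWithinAt_pi.1 (hx t ht).2 2).congr_deriv (by simp [ricciCoeff]; ring)

end IsDiagFlowOn

theorem antitoneOn_of_hasDerivWithinAt_self {f f' : ℝ → ℝ} {D : Set ℝ} (hD : Convex ℝ D)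
    (hf : ∀ t ∈ D, HasDerivWithinAt f (f' t) D t) (hf' : ∀ t ∈ D, f' t ≤ 0) : AntitoneOn f D :=
  antitoneOn_of_hasDerivWithinAt_nonpos hD (fun t ht => (hf t ht).continuousWithinAt)
    (fun t ht => (hf t (interior_subset ht)).mono interior_subset)
    fun t ht => hf' t (interior_subset ht)

namespace IsDiagFlowOn

variable {x : ℝ → Fin 3 → ℝ} {S : Set ℝ}

theorem antitoneOn_zero (hx : IsDiagFlowOn x S) (hS : Convex ℝ S) :
    AntitoneOn (fun t => x t 0) S :=
  antitoneOn_of_hasDerivWithinAt_self hS (fun _ ht => hx.hasDerivWithinAt_zero ht) fun t _ => by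
    have := sq_nonneg (x t 0 / x t 1)
    have := sq_nonneg (x t 0 / x t 2)
    linarith

/-- With `u = x₀ / x₁`, the derivative of `x₀ + x₁` is at most `-1 + (u - u²) / 20 < -1 / 2`. -/
theorem antitoneOn_zero_add_one (hx : IsDiagFlowOn x S) (hS : Convex ℝ S) :
    AntitoneOn (fun t => x t 0 + x t 1 + t / 2) S :=
  antitoneOn_of_hasDerivWithinAt_self hS (fun t ht =>
    ((hx.hasDerivWithinAt_zero ht).add (hx.hasDerivWithinAt_one ht)).add
      ((hasDerivWithinAt_id t S).div_const 2)) fun t _ => by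
    have := sq_nonneg (x t 0 / x t 1 - 1 / 2)
    have := sq_nonneg (x t 0 / x t 2)
    linarith

theorem antitoneOn_zero_add_two (hx : IsDiagFlowOn x S) (hS : Convex ℝ S) :
    AntitoneOn (fun t => x t 0 + x t 2) S :=
  antitoneOn_of_hasDerivWithinAt_self hS (fun t ht =>
    (hx.hasDerivWithinAt_zero ht).add (hx.hasDerivWithinAt_two ht)) fun t _ => by
    have := sq_nonneg (x t 0 / x t 1)
    have := sq_nonneg (x t 0 / x t 2 - 1 / 2)
    linarith

end IsDiagFlowOn

/-! ### Behaviour at the end of the flow -/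

open Filter Topology Set

theorem exists_tendsto_of_antitoneOn {f : ℝ → ℝ} {T : ℝ} (hT : 0 < T)
    (hf : AntitoneOn f (Ico 0 T)) (hpos : ∀ t ∈ Ico 0 T, 0 ≤ f t) :
    ∃ L, 0 ≤ L ∧ Tendsto f (𝓝[<] T) (𝓝 L) :=
  ⟨_, Real.sInf_nonneg (by rintro _ ⟨t, ht, rfl⟩; exact hpos t (Ioo_subset_Ico_self ht)),
    (hf.mono Ioo_subset_Ico_self).tendsto_nhdsWithin_Ioo_left (nonempty_Ioo.2 hT)
      ⟨0, by rintro _ ⟨t, ht, rfl⟩; exact hpos t (Ioo_subset_Ico_self ht)⟩⟩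

/-- A positive function that decreases to `0` cannot have nonnegative derivative up to the end. -/
theorem not_tendsto_zero_of_hasDerivWithinAt_nonneg {f f' : ℝ → ℝ} {T : ℝ} (hT : 0 < T)
    (hf : ∀ t ∈ Ico 0 T, HasDerivWithinAt f (f' t) (Ico 0 T) t)
    (hpos : ∀ t ∈ Ico 0 T, 0 < f t) (hf' : ∀ᶠ t in 𝓝[<] T, 0 ≤ f' t) :
    ¬ Tendsto f (𝓝[<] T) (𝓝 0) := by
  intro h
  obtain ⟨a, ha, haT⟩ := mem_nhdsLT_iff_exists_Ico_subset.1
    (inter_mem hf' (Ico_mem_nhdsLT hT))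
  have hsub : Ico a T ⊆ Ico 0 T := fun t ht => (haT ht).2
  have hmono : AntitoneOn (fun t => -f t) (Ico a T) :=
    antitoneOn_of_hasDerivWithinAt_self (convex_Ico a T)
      (fun t ht => ((hf t (hsub ht)).mono hsub).neg) fun t ht => neg_nonpos.2 (haT ht).1
  have haa : a ∈ Ico a T := ⟨le_rfl, ha⟩
  have hle : f a ≤ 0 := ge_of_tendsto h (by
    filter_upwards [Ico_mem_nhdsLT ha] with t ht
    exact neg_le_neg_iff.1 (hmono haa ht ht.1))
  exact (hpos a (hsub haa)).not_ge hle

namespace IsDiagFlowOn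

variable {x : ℝ → Fin 3 → ℝ} {T : ℝ}

/-- As long as the base does not collapse the fibre does not either, since the derivative of
`1 / x₀` is `(1 / x₁² + 9 / x₂²) / 20`. -/
theorem limit_zero_pos (hx : IsDiagFlowOn x (Ico 0 T)) (hT : 0 < T) {L : Fin 3 → ℝ}
    (hL : ∀ i, Tendsto (fun t => x t i) (𝓝[<] T) (𝓝 (L i))) (h1 : 0 < L 1) (h2 : 0 < L 2) :
    0 < L 0 := by
  obtain ⟨a, ha, haT⟩ := mem_nhdsLT_iff_exists_Ico_subset.1
    (inter_mem (Ico_mem_nhdsLT hT) (inter_mem ((hL 1).eventually (lt_mem_nhds (half_lt_self h1)))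
      ((hL 2).eventually (lt_mem_nhds (half_lt_self h2)))))
  have hsub : Ico a T ⊆ Ico 0 T := fun t ht => (haT ht).1
  set M : ℝ := (1 / (L 1 / 2) ^ 2 + 9 * (1 / (L 2 / 2) ^ 2)) / 20 with hM
  have hMpos : 0 ≤ M := by positivity
  have hanti : AntitoneOn (fun t => (x t 0)⁻¹ - M * t) (Ico a T) := by
    refine antitoneOn_of_hasDerivWithinAt_self (convex_Ico a T) (fun t ht =>
      (((hx.mono hsub).hasDerivWithinAt_zero ht).inv ((hx t (hsub ht)).1 0).ne').sub
        ((hasDerivWithinAt_id t _).const_mul M)) fun t ht => ?_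
    have p0 := (hx t (hsub ht)).1 0
    have p1 := (hx t (hsub ht)).1 1
    have p2 := (hx t (hsub ht)).1 2
    have q1 : L 1 / 2 < x t 1 := (haT ht).2.1
    have q2 : L 2 / 2 < x t 2 := (haT ht).2.2
    have e1 : 1 / x t 1 ^ 2 ≤ 1 / (L 1 / 2) ^ 2 := by gcongr
    have e2 : 1 / x t 2 ^ 2 ≤ 1 / (L 2 / 2) ^ 2 := by gcongr
    have e : -(-((x t 0 / x t 1) ^ 2 + 9 * (x t 0 / x t 2) ^ 2) / 20) / x t 0 ^ 2 =
        (1 / x t 1 ^ 2 + 9 * (1 / x t 2 ^ 2)) / 20 := by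
      field_simp
    rw [e, mul_one]
    linarith
  have haa : a ∈ Ico a T := ⟨le_rfl, ha⟩
  have pa := (hx a (hsub haa)).1 0
  set C : ℝ := (x a 0)⁻¹ + M * (T - a) with hC
  have hCpos : 0 < C := by
    have : 0 ≤ M * (T - a) := mul_nonneg hMpos (sub_nonneg.2 (le_of_lt ha))
    positivity
  refine (inv_pos.2 hCpos).trans_le (ge_of_tendsto (hL 0) ?_)
  filter_upwards [Ico_mem_nhdsLT ha] with t ht
  have pt := (hx t (hsub ht)).1 0
  have h := hanti haa ht ht.1
  have hMt : M * t ≤ M * T := mul_le_mul_of_nonneg_left ht.2.le hMpos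
  refine inv_le_of_inv_le₀ pt ?_
  simp only at h
  linarith

/-- If the fibre does not collapse, then neither does the first base factor: a small `x₁` would make the
derivative `-1 + x₀ / (20 x₁)` positive. -/
theorem limit_one_ne_zero (hx : IsDiagFlowOn x (Ico 0 T)) (hT : 0 < T) {L : Fin 3 → ℝ}
    (hL : ∀ i, Tendsto (fun t => x t i) (𝓝[<] T) (𝓝 (L i))) (h0 : 0 < L 0) : L 1 ≠ 0 := by
  intro h1
  have hlim := hL 1
  rw [h1] at hlim
  refine not_tendsto_zero_of_hasDerivWithinAt_nonneg hT
    (fun t ht => hx.hasDerivWithinAt_one ht) (fun t ht => (hx t ht).1 1) ?_ hlim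
  filter_upwards [Ico_mem_nhdsLT hT, (hL 0).eventually (lt_mem_nhds (half_lt_self h0)),
    hlim.eventually (gt_mem_nhds (show 0 < L 0 / 40 by positivity))] with t ht q0 q1
  have : 20 ≤ x t 0 / x t 1 := (le_div_iff₀ ((hx t ht).1 1)).2 (by linarith)
  linarith

theorem limit_two_ne_zero (hx : IsDiagFlowOn x (Ico 0 T)) (hT : 0 < T) {L : Fin 3 → ℝ}
    (hL : ∀ i, Tendsto (fun t => x t i) (𝓝[<] T) (𝓝 (L i))) (h0 : 0 < L 0) : L 2 ≠ 0 := by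
  intro h2
  have hlim := hL 2
  rw [h2] at hlim
  refine not_tendsto_zero_of_hasDerivWithinAt_nonneg hT
    (fun t ht => hx.hasDerivWithinAt_two ht) (fun t ht => (hx t ht).1 2) ?_ hlim
  filter_upwards [Ico_mem_nhdsLT hT, (hL 0).eventually (lt_mem_nhds (half_lt_self h0)),
    hlim.eventually (gt_mem_nhds (show 0 < L 0 / 40 by positivity))] with t ht q0 q2
  have : 20 ≤ x t 0 / x t 2 := (le_div_iff₀ ((hx t ht).1 2)).2 (by linarith)
  linarith

theorem exists_limit (hx : IsDiagFlowOn x (Ico 0 T)) (hT : 0 < T) :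
    ∃ L : Fin 3 → ℝ, (∀ i, 0 ≤ L i) ∧ ∀ i, Tendsto (fun t => x t i) (𝓝[<] T) (𝓝 (L i)) := by
  have hpos (t : ℝ) (ht : t ∈ Ico 0 T) (i : Fin 3) : 0 < x t i := (hx t ht).1 i
  obtain ⟨L₀, hL₀, h₀⟩ := exists_tendsto_of_antitoneOn hT (hx.antitoneOn_zero (convex_Ico 0 T))
    fun t ht => (hpos t ht 0).le
  obtain ⟨M₁, -, h₁⟩ := exists_tendsto_of_antitoneOn hT
    (hx.antitoneOn_zero_add_one (convex_Ico 0 T)) fun t ht => by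
      have := hpos t ht 0
      have := hpos t ht 1
      have := ht.1
      positivity
  obtain ⟨M₂, -, h₂⟩ := exists_tendsto_of_antitoneOn hT
    (hx.antitoneOn_zero_add_two (convex_Ico 0 T)) fun t ht =>
      (add_pos (hpos t ht 0) (hpos t ht 2)).le
  have hid : Tendsto (fun t : ℝ => t / 2) (𝓝[<] T) (𝓝 (T / 2)) :=
    (tendsto_id.mono_left nhdsWithin_le_nhds).div_const 2
  have k₁ : Tendsto (fun t => x t 1) (𝓝[<] T) (𝓝 (M₁ - L₀ - T / 2)) :=
    ((h₁.sub h₀).sub hid).congr fun t => by ring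
  have k₂ : Tendsto (fun t => x t 2) (𝓝[<] T) (𝓝 (M₂ - L₀)) :=
    (h₂.sub h₀).congr fun t => by ring
  have hlim (i : Fin 3) : Tendsto (fun t => x t i) (𝓝[<] T)
      (𝓝 ((![L₀, M₁ - L₀ - T / 2, M₂ - L₀] : Fin 3 → ℝ) i)) := by
    fin_cases i
    exacts [h₀, k₁, k₂]
  refine ⟨_, fun i => ge_of_tendsto (hlim i) ?_, hlim⟩
  filter_upwards [Ico_mem_nhdsLT hT] with t ht using (hpos t ht i).le

theorem contDiffAt_ricciCoeff {L : Fin 3 → ℝ} (hL : ∀ i, 0 < L i) :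
    ContDiffAt ℝ 1 (fun y : Fin 3 → ℝ => fun i => -2 * ricciCoeff y i) L := by
  have h (i : Fin 3) : ContDiffAt ℝ 1 (fun y : Fin 3 → ℝ => y i) L :=
    (contDiff_apply ℝ ℝ i).contDiffAt
  have h1 : ContDiffAt ℝ 1 (fun y : Fin 3 → ℝ => y 0 / y 1) L := (h 0).div (h 1) (hL 1).ne'
  have h2 : ContDiffAt ℝ 1 (fun y : Fin 3 → ℝ => y 0 / y 2) L := (h 0).div (h 2) (hL 2).ne'
  refine contDiffAt_pi.2 fun i => ?_
  fin_cases i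
  · exact contDiffAt_const.mul (((h1.pow 2).add (contDiffAt_const.mul (h2.pow 2))).div_const 40)
  · exact contDiffAt_const.mul ((contDiffAt_const.sub (h1.div_const 20)).div_const 2)
  · exact contDiffAt_const.mul
      ((contDiffAt_const.sub ((contDiffAt_const.mul h2).div_const 20)).div_const 2)

/-- A solution with a positive limit at a finite time extends beyond that time. -/
theorem exists_extension (hx : IsDiagFlowOn x (Ico 0 T)) (hT : 0 < T) {L : Fin 3 → ℝ}
    (hL : ∀ i, Tendsto (fun t => x t i) (𝓝[<] T) (𝓝 (L i))) (hpos : ∀ i, 0 < L i) :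
    ∃ T' > T, ∃ y : ℝ → Fin 3 → ℝ, IsDiagFlowOn y (Ico 0 T') ∧ ∀ t ∈ Ico 0 T, y t = x t := by
  set F : (Fin 3 → ℝ) → Fin 3 → ℝ := fun y i => -2 * ricciCoeff y i
  have hlim : Tendsto x (𝓝[<] T) (𝓝 L) := tendsto_pi_nhds.2 hL
  obtain ⟨α, hα, ε, hε, hsol⟩ := (contDiffAt_ricciCoeff hpos)
    |>.exists_forall_mem_closedBall_exists_eq_forall_mem_Ioo_hasDerivAt₀ T
  change ∀ t ∈ Ioo (T - ε) (T + ε), HasDerivAt α (F (α t)) t at hsol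
  have hTmem : T ∈ Ioo (T - ε) (T + ε) := ⟨by linarith, by linarith⟩
  have hαpos : ∀ᶠ t in 𝓝[≥] T, (∀ i, 0 < α t i) ∧ t ∈ Ioo (T - ε) (T + ε) := by
    refine nhdsWithin_le_nhds (Filter.Eventually.and ?_ (isOpen_Ioo.mem_nhds hTmem))
    refine eventually_all.2 fun i => ?_
    have hc : ContinuousAt (fun t => α t i) T :=
      (continuous_apply i).continuousAt.comp (hsol T hTmem).continuousAt
    exact hc.eventually (lt_mem_nhds (by simpa [hα] using hpos i))
  obtain ⟨T', hT', hsub⟩ := mem_nhdsGE_iff_exists_Ico_subset.1 hαpos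
  refine ⟨T', hT', fun t => if t < T then x t else α t, ?_, fun t ht => if_pos ht.2⟩
  set y : ℝ → Fin 3 → ℝ := fun t => if t < T then x t else α t
  have hyx (t : ℝ) (ht : t < T) : y t = x t := if_pos ht
  have hyα (t : ℝ) (ht : T ≤ t) : y t = α t := if_neg ht.not_gt
  intro t ht
  change _ ∧ HasDerivWithinAt y (F (y t)) _ t
  rcases lt_trichotomy t T with hlt | rfl | hgt
  · have htm : t ∈ Ico 0 T := ⟨ht.1, hlt⟩
    rw [hyx t hlt]
    refine ⟨(hx t htm).1, ?_⟩
    have h : HasDerivWithinAt y (F (x t)) (Ico 0 T) t :=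
      (hx t htm).2.congr (fun s hs => hyx s hs.2) (hyx t hlt)
    refine h.mono_of_mem_nhdsWithin ?_
    filter_upwards [self_mem_nhdsWithin, nhdsWithin_le_nhds (Iio_mem_nhds hlt)] with s hs hs'
    exact ⟨hs.1, hs'⟩
  · -- At the junction the left derivative is the limit of the derivatives of `x`.
    rw [hyα t le_rfl, hα]
    refine ⟨hpos, HasDerivAt.hasDerivWithinAt ?_⟩
    have hder (s : ℝ) (hs : s ∈ Ioo 0 t) : HasDerivAt y (F (x s)) s := by
      have hn : Ico 0 t ∈ 𝓝 s := Ico_mem_nhds hs.1 hs.2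
      refine ((hx s (Ioo_subset_Ico_self hs)).2.hasDerivAt hn).congr_of_eventuallyEq ?_
      filter_upwards [Iio_mem_nhds hs.2] with r hr using hyx r hr
    have hleft : HasDerivWithinAt y (F L) (Iic t) t := by
      refine hasDerivWithinAt_Iic_of_tendsto_deriv (s := Ioo 0 t)
        (fun s hs => (hder s hs).differentiableAt.differentiableWithinAt) ?_
        (Ioo_mem_nhdsLT hT) ?_
      · rw [ContinuousWithinAt, hyα t le_rfl, hα]
        refine (hlim.mono_left (nhdsWithin_mono _ fun s hs => hs.2)).congr' ?_
        filter_upwards [self_mem_nhdsWithin] with s hs using (hyx s hs.2).symm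
      · refine ((contDiffAt_ricciCoeff hpos).continuousAt.tendsto.comp hlim).congr' ?_
        filter_upwards [Ioo_mem_nhdsLT hT] with s hs using (hder s hs).deriv.symm
    have hright : HasDerivWithinAt y (F L) (Ici t) t := by
      have h := (hsol t hTmem).hasDerivWithinAt (s := Ici t)
      rw [hα] at h
      exact h.congr (fun s hs => hyα s hs) (hyα t le_rfl)
    have h := hleft.union hright
    rwa [Iic_union_Ici, hasDerivWithinAt_univ] at h
  · rw [hyα t hgt.le]
    have hmem := hsub ⟨hgt.le, ht.2⟩
    refine ⟨hmem.1, HasDerivAt.hasDerivWithinAt ?_⟩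
    refine (hsol t hmem.2).congr_of_eventuallyEq ?_
    filter_upwards [Ioi_mem_nhds hgt] with s hs using hyα s (le_of_lt hs)

end IsDiagFlowOn

theorem timeInterval_coe (T : ℝ) : timeInterval (T : EReal) = Ico 0 T := by
  ext t
  simp [timeInterval]

/-- The flow ends in finite time, since `x₀ + x₁ + t / 2` does not increase. -/
theorem IsDiagFlowOn.exists_eq_coe {x : ℝ → Fin 3 → ℝ} {T : EReal} (hT : 0 < T)
    (hx : IsDiagFlowOn x (timeInterval T)) : ∃ T₀ : ℝ, T = (T₀ : EReal) := by
  induction T with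
  | bot => exact absurd hT (by simp)
  | coe T₀ => exact ⟨T₀, rfl⟩
  | top =>
    have hS : timeInterval ⊤ = Ici 0 := by
      ext t
      simp [timeInterval]
    rw [hS] at hx
    have p0 := (hx 0 self_mem_Ici).1 0
    have p1 := (hx 0 self_mem_Ici).1 1
    have ht : 2 * (x 0 0 + x 0 1) ∈ Ici (0 : ℝ) := by
      rw [mem_Ici]
      positivity
    have h := hx.antitoneOn_zero_add_one (convex_Ici 0) self_mem_Ici ht ht
    have q0 := (hx _ ht).1 0
    have q1 := (hx _ ht).1 1
    simp only at h
    linarith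

end

end G2Flag

theorem mainTheorem8
    (g : ℝ → LinearMap.BilinForm ℝ G2Flag.mTheta) (T : EReal) (hT : 0 < T)
    (hg : G2Flag.IsMaximalRicciFlow g T)
    (A : ℝ → G2Flag.mTheta →ₗ[ℝ] G2Flag.mTheta)
    (hA : ∀ t ∈ G2Flag.timeInterval T, G2Flag.IsMetricOperator (g t) (A t)) :
    ∃ (T₀ : ℝ) (μ : Fin 3 → ℝ → ℝ), T = (T₀ : EReal) ∧
      (∀ t ∈ G2Flag.timeInterval T, ∀ i, 0 < μ i t ∧
        ∀ X ∈ G2Flag.summand i, A t X = μ i t • X) ∧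
      Filter.Tendsto (μ 0) (nhdsWithin T₀ (Set.Iio T₀)) (nhds 0) ∧
      (Filter.Tendsto (μ 1) (nhdsWithin T₀ (Set.Iio T₀)) (nhds 0) ∨
        Filter.Tendsto (μ 2) (nhdsWithin T₀ (Set.Iio T₀)) (nhds 0)) := by
  obtain ⟨x, hx, hgx⟩ := hg.1.exists_isDiagFlowOn
  obtain ⟨T₀, rfl⟩ := hx.exists_eq_coe hT
  have hT₀ : 0 < T₀ := by exact_mod_cast hT
  have hx' := hx
  rw [G2Flag.timeInterval_coe] at hx'
  obtain ⟨L, hL, hlim⟩ := hx'.exists_limit hT₀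
  refine ⟨T₀, fun i t => x t i, rfl, fun t ht i => ⟨(hx t ht).1 i, fun X hX => ?_⟩, ?_⟩
  · have hAt := hA t ht
    rw [hgx t ht] at hAt
    exact hAt.apply_of_mem_summand hX
  have hbase : L 1 = 0 ∨ L 2 = 0 := by
    by_contra! h
    have h1 := (hL 1).lt_of_ne' h.1
    have h2 := (hL 2).lt_of_ne' h.2
    have h0 := hx'.limit_zero_pos hT₀ hlim h1 h2
    obtain ⟨T', hT', y, hy, hyx⟩ := hx'.exists_extension hT₀ hlim fun i => by
      fin_cases i
      exacts [h0, h1, h2]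
    rw [← G2Flag.timeInterval_coe] at hy
    refine absurd (hg.2 _ T' hy.isRicciFlow fun t ht => ?_)
      (not_le.2 (EReal.coe_lt_coe_iff.2 hT'))
    rw [hgx t ht, hyx t (by rwa [← G2Flag.timeInterval_coe])]
  have hfibre : L 0 = 0 := by
    by_contra h
    have h0 := (hL 0).lt_of_ne' h
    exact hbase.elim (hx'.limit_one_ne_zero hT₀ hlim h0) (hx'.limit_two_ne_zero hT₀ hlim h0)
  refine ⟨hfibre ▸ hlim 0, hbase.imp (fun h => ?_) fun h => ?_⟩
  · exact h ▸ hlim 1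
  · exact h ▸ hlim 2
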